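/- Let $M,K,N\ge 1$ be integers with $\gcd(M,K)=1$ and $\gcd(M+K,N)=1$. Let $I_n^t,V_n^t\in\mathbb C$ $(n,t\in\mathbb Z$; the superscript is a time index$)$, with all $I_n^t\neq 0$, satisfy $$I_n^t=I_{n-1}^{t-M}+V_n^{t-K}-V_{n-1}^t,\qquad V_n^t=\frac{I_n^{t-M}V_n^{t-K}}{I_n^t},\qquad I_{n+N}^t=I_n^t,\quad V_{n+N}^t=V_n^t .$$ Let $S(y)$ be the $N\times N$ matrix with ones on the superdiagonal, $y$ in the lower left corner and zeros elsewhere ($S(y)=(y)$ if $N=1$), put $L_t(y)=\mathrm{diag}(V_1^t,\dots,V_N^t)+S(y)$, $R_t(y)=\mathrm{diag}(I_1^t,\dots,I_N^t)+S(y)$ and $$X_t(y)=L_{t-(K-1)M}(y)\cdots L_{t-M}(y)L_t(y)\,R_t(y)R_{t-K}(y)\cdots R_{t-(M-1)K}(y).$$ Assume that the affine curve $\widetilde C=\{(x,y)\in\mathbb C^2 : \det(X_t(y)-xE)=0\}$ (it does not depend on $t$) is smooth, that is, the two partial derivatives of $\det(X_t(y)-xE)$ do not vanish simultaneously at any point of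 it, and let $C$, the spectral curve, be its smooth completion. Then: (i), (ii) $C$ has $M$ points $A_j$ with $(x,y)=\bigl(0,(-1)^N\prod_{n=1}^N I_n^{-jK}\bigr)$, $0\le j\le M-1$, and $K$ points $B_j$ with $(x,y)=\bigl(0,(-1)^N\prod_{n=1}^N V_n^{-jM}\bigr)$, $0\le j\le K-1$. Each is the only point of $C$ with these coordinates, and, counted with multiplicity, they are all the zeros of $x$: $(x)_0=\sum_j A_j+\sum_j B_j$. (iii) Put $U_j=\prod_{k=1}^K V_j^{s-k}\cdot\prod_{k=1}^M I_j^{s-k}$; this does not depend on $s\in\mathbb Z$. Then $C$ has $N$ points $Q_j$ with $(x,y)=(U_j,0)$, $1\le j\le N$. Each is the only point of $C$ with these coordinates, and $(y)_0=\sum_j Q_j$. (iv) There is a point $P\in C$ at which both $x$ and $y$ have a pole, and $P$ is the only point of $C$ at which $x$ or $y$ has a pole. There is a local coordinate $k$ at $P$ with $$x=k^{-(M+K)}+\cdots,\qquad y=k^{-N}+\cdots,$$ the dots being terms of higher order in $k$. For every $s\in\mathbb Z$ there is a nonzero vector $v$ of rational functions on $C$ with $X_s(y)v=x\,v$, and every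 such $v=(v_1,\dots,v_N)^T$ satisfies, after multiplication by a suitable nonzero rational function, $v_i=k^{N-i}+(\text{higher order terms in }k)$ at $P$ for $i=1,\dots,N$, that is, $v\sim(k^{N-1},\dots,k,1)^T$. -/

import Mathlib

open Polynomial
open scoped WithZero

noncomputable section

namespace RndKP

/-- A solution of the `(M,K)`-reduced non-autonomous discrete KP equation with period `N`;
`I n t` and `V n t` stand for `I_n^t` and `V_n^t`. Since the equation divides by `I_n^t`, these
numbers are nonzero. -/
structure IsSolution (M K N : ℕ) (I V : ℤ → ℤ → ℂ) : Prop where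
  I_ne_zero : ∀ n t, I n t ≠ 0
  eq_I : ∀ n t, I n t = I (n - 1) (t - M) + V n (t - K) - V (n - 1) t
  eq_V : ∀ n t, V n t = I n (t - M) * V n (t - K) / I n t
  I_periodic : ∀ n t, I (n + N) t = I n t
  V_periodic : ∀ n t, V (n + N) t = V n t

/-- The matrix `S(y)`, with ones above the diagonal and `y` in the lower left corner
(for `N = 1` it is the `1 × 1` matrix `(y)`). The variable of `ℂ[X]` is `y`. -/
def shiftMatrix (N : ℕ) : Matrix (Fin N) (Fin N) ℂ[X] := fun i j =>
  if (i : ℕ) + 1 = j then 1 else if (i : ℕ) + 1 = N ∧ (j : ℕ) = 0 then X else 0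

/-- The matrix `diag(d_1, …, d_N) + S(y)`. It is `L_t(y)` for `d_n = V_n^t` and `R_t(y)` for
`d_n = I_n^t`. -/
def bidiagonal (N : ℕ) (d : ℤ → ℂ) : Matrix (Fin N) (Fin N) ℂ[X] :=
  Matrix.diagonal (fun i : Fin N => C (d ((i : ℤ) + 1))) + shiftMatrix N

/-- `X_t(y) = L_{t-(K-1)M}(y) ⋯ L_{t-M}(y) L_t(y) R_t(y) R_{t-K}(y) ⋯ R_{t-(M-1)K}(y)`. -/
def laxMatrix (M K N : ℕ) (I V : ℤ → ℤ → ℂ) (t : ℤ) : Matrix (Fin N) (Fin N) ℂ[X] :=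
  ((List.range K).reverse.map fun j : ℕ => bidiagonal N fun n => V n (t - j * M)).prod *
    ((List.range M).map fun j : ℕ => bidiagonal N fun n => I n (t - j * K)).prod

/-- The polynomial `det (x E - X_t(y))` of the affine spectral curve. The outer variable is `x`,
the inner variable is `y`. -/
def spectralPoly (M K N : ℕ) (I V : ℤ → ℤ → ℂ) (t : ℤ) : ℂ[X][X] :=
  (laxMatrix M K N I V t).charpoly

/-- The affine plane curve `F(x, y) = 0` (outer variable `x`, inner variable `y`) is smooth: at no
point `(a, b)` of it do both partial derivatives of `F` vanish. -/
def IsSmoothAffine (F : ℂ[X][X]) : Prop :=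
  ∀ a b : ℂ, F.evalEval b a = 0 →
    (derivative (F.map (evalRingHom b))).eval a ≠ 0 ∨ (derivative (F.eval (C a))).eval b ≠ 0

/-- The ring of rational functions on the affine plane curve `F(x, y) = 0`: the total ring of
fractions of its coordinate ring (the function field, if `F` is irreducible). -/
abbrev RatFun (F : ℂ[X][X]) : Type := FractionRing (AdjoinRoot F)

/-- The coordinate function `x`. -/
def xFun (F : ℂ[X][X]) : RatFun F := algebraMap (AdjoinRoot F) (RatFun F) (AdjoinRoot.root F)

/-- The coordinate function `y`. -/
def yFun (F : ℂ[X][X]) : RatFun F := algebraMap (AdjoinRoot F) (RatFun F) (AdjoinRoot.of F X)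

/-- The points of the smooth complete curve that has the same rational functions as the plane
curve `F(x, y) = 0`: the normalised discrete valuations of the ring of rational functions that are
trivial on the constants. The valuation is written multiplicatively: `val f = exp (-n)` means
that `f` has order `n` at the point, and `val f = 0` means that `f` vanishes identically on the
component of the point. -/
@[ext]
structure CurvePoint (F : ℂ[X][X]) where
  val : Valuation (RatFun F) ℤᵐ⁰
  surjective : Function.Surjective val
  val_const : ∀ c : ℂ, c ≠ 0 → val (algebraMap ℂ (RatFun F) c) = 1

namespace CurvePoint

variable {F : ℂ[X][X]}

/-- The rational function `f` is regular at `p` with value `c`. -/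
def HasValue (p : CurvePoint F) (f : RatFun F) (c : ℂ) : Prop :=
  p.val (f - algebraMap ℂ (RatFun F) c) < 1

/-- The rational function `f` has a pole at `p`, that is, `f(p) = ∞`. -/
def HasPole (p : CurvePoint F) (f : RatFun F) : Prop := 1 < p.val f

/-- The rational function `f` has order exactly `n` at `p`. -/
def HasOrder (p : CurvePoint F) (f : RatFun F) (n : ℤ) : Prop := p.val f = WithZero.exp (-n)

/-- `f = g + (terms of higher order)` at `p`. -/
def LeadingTerm (p : CurvePoint F) (f g : RatFun F) : Prop := p.val (f - g) < p.val g

/-- `p` is the point `(x, y) = (a, b)`: it has these coordinates, and no other point has them. -/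
def IsPointAt (p : CurvePoint F) (a b : ℂ) : Prop :=
  (p.HasValue (xFun F) a ∧ p.HasValue (yFun F) b) ∧
    ∀ q : CurvePoint F, q.HasValue (xFun F) a → q.HasValue (yFun F) b → q = p

end CurvePoint

/-- `w` is a nonzero vector of rational functions on `F(x, y) = 0` with `Z(y) w = x w`. -/
def IsEigenvector (F : ℂ[X][X]) {N : ℕ} (Z : Matrix (Fin N) (Fin N) ℂ[X]) (w : Fin N → RatFun F) :
    Prop :=
  w ≠ 0 ∧ (Z.map (algebraMap ℂ[X] (RatFun F))).mulVec w = xFun F • w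

end RndKP

end

/-! The recurrences yield `L_t R_t = R_{t-M} L_{t-K}`, so `X_{t-M}` and `X_{t-K}` have the same
characteristic polynomial as `X_t`: each arises by moving one factor through the product and
permuting cyclically. Since `M` and `K` are coprime, the curve `F` is independent of time
(`IsSolution.spectralPoly_eq`).

Everything at infinity comes from a grading. Put `m = M + K`. With `y = z ^ N`, conjugating by
`diag(z ^ i)` and dividing by `z ^ m` turns each factor `diag(d) + S(y)` into `z⁻¹ diag(d) + S(1)`.
At `z = ∞` only `S(1) ^ m` is left, with characteristic polynomial `x ^ N - 1` because `m` and `N`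
are coprime. Hence `F = x ^ N - y ^ m +` terms of lower weight, where `x` has weight `m` and `y`
weight `N` (`cyclicCurve_coeff_coeff`). The simple root `1` lifts by Hensel to a Laurent series
point (`exists_laurentSeries_point_at_infinity`). Monomials `x ^ a y ^ b` with `a < N` have distinct
weights, so at a pole of `y` the order of every function is forced (`val_aevalAeval_eq`); this gives
both the irreducibility of `F` and the uniqueness of `P`. A Bézout monomial in `x` and `y` is the
local parameter, and a rescaled eigenvector reduces at `P` to a vector fixed by `S(1) ^ m`, hence to
a constant one (`exists_scaling_of_eigenvector`).

At finite distance, smoothness makes `x - a` or `y - b` a local parameter, so each solution of `F(a,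
b) = 0` carries exactly one valuation, and the order of `x - a` there is the multiplicity of `b` as
a root of `F(a, y)` (`val_sub_eq_exp_rootMultiplicity`). Now `F(0, y)` is up to a constant the
product of the determinants of the factors, and `F(x, 0)` belongs to a triangular matrix; their
roots are the coordinates of `A_j`, `B_j` and `Q_j`. That `U_j` is the diagonal entry of `X_t(0)`
and independent of `s` is an identity between polynomials in the time shift
(`sum_range_add_sum_range_eq`). -/

noncomputable section

namespace RndKP

/-! ### Products of cyclic bidiagonal matrices: grading, spectrum, determinant. -/

section CyclicBidiagonal

variable {R S : Type*} [CommRing R] [CommRing S] {N : ℕ}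

/-- The matrix `diag(d_0, …, d_{N-1}) + S(y)` over a commutative ring. -/
def cyclicBidiagonal (d : Fin N → R) (y : R) : Matrix (Fin N) (Fin N) R :=
  Matrix.diagonal d + Matrix.of fun i j : Fin N =>
    if (i : ℕ) + 1 = j then 1 else if (i : ℕ) + 1 = N ∧ (j : ℕ) = 0 then y else 0

/-- The product of the matrices `diag(d) + S(y)`, where `d` runs through a list. -/
def cyclicProd (ds : List (Fin N → R)) (y : R) : Matrix (Fin N) (Fin N) R :=
  (ds.map fun d => cyclicBidiagonal d y).prod

theorem cyclicBidiagonal_map (f : R →+* S) (d : Fin N → R) (y : R) :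
    (cyclicBidiagonal d y).map f = cyclicBidiagonal (fun i => f (d i)) (f y) := by
  ext i j
  simp only [cyclicBidiagonal, Matrix.map_apply, Matrix.add_apply, Matrix.diagonal_apply,
    Matrix.of_apply, map_add]
  congr 1 <;> split_ifs <;> simp

theorem cyclicProd_map (f : R →+* S) (ds : List (Fin N → R)) (y : R) :
    (cyclicProd ds y).map f = cyclicProd (ds.map fun d i => f (d i)) (f y) := by
  change f.mapMatrix _ = _
  rw [cyclicProd, cyclicProd, map_list_prod, List.map_map, List.map_map]
  congr 2
  funext d
  exact cyclicBidiagonal_map f d y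

/-- The grading behind all statements at infinity: an entry just above the diagonal gains one `z`
under conjugation, and the corner entry loses `z ^ (N - 1)`. Here `κ` plays the part of `z⁻¹`. -/
theorem cyclicBidiagonal_mul_diagonal {z κ : R} (h : κ * z = 1) (d : Fin N → R) (y : R) :
    cyclicBidiagonal d y * Matrix.diagonal (fun i : Fin N => z ^ (i : ℕ)) =
      z • (Matrix.diagonal (fun i : Fin N => z ^ (i : ℕ)) *
        cyclicBidiagonal (fun i => κ * d i) (y * κ ^ N)) := by
  have hp : ∀ n, z ^ n * κ ^ n = 1 := fun n => by rw [← mul_pow, mul_comm, h, one_pow]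
  ext i j
  simp only [cyclicBidiagonal, Matrix.smul_apply, Matrix.mul_diagonal, Matrix.diagonal_mul,
    Matrix.add_apply, Matrix.diagonal_apply, Matrix.of_apply, smul_eq_mul]
  by_cases hij : i = j
  · subst hij
    -- For `N = 1` the corner lies on the diagonal, so both contributions meet in one entry.
    by_cases hN : (i : ℕ) + 1 = N ∧ (i : ℕ) = 0
    · obtain ⟨h1, h2⟩ := hN
      have hN1 : N = 1 := by omega
      simp only [h2, ← h1]
      simp
      linear_combination (-d i - y) * h
    · simp [hN]
      linear_combination (-d i * z ^ (i : ℕ)) * h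
  · by_cases h1 : (i : ℕ) + 1 = j
    · rw [if_neg hij, if_pos h1, if_neg hij, if_pos h1, ← h1, pow_succ]; ring
    · by_cases hN : (i : ℕ) + 1 = N ∧ (j : ℕ) = 0
      · obtain ⟨h2, h3⟩ := hN
        have h4 : N ≠ 0 := by omega
        have h5 : z ^ N = z ^ (i : ℕ) * z := by rw [← pow_succ, h2]
        simp only [hij, h2, h3, h4, and_self, if_true, if_false, zero_add, pow_zero]
        linear_combination (-y) * hp N + y * κ ^ N * h5
      · simp [hij, h1, hN]

theorem cyclicProd_mul_diagonal {z κ : R} (h : κ * z = 1) (ds : List (Fin N → R)) (y : R) :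
    cyclicProd ds y * Matrix.diagonal (fun i : Fin N => z ^ (i : ℕ)) =
      z ^ ds.length • (Matrix.diagonal (fun i : Fin N => z ^ (i : ℕ)) *
        cyclicProd (ds.map fun d i => κ * d i) (y * κ ^ N)) := by
  induction ds with
  | nil => simp [cyclicProd]
  | cons d ds ih =>
    simp only [cyclicProd, List.map_cons, List.prod_cons, List.length_cons] at ih ⊢
    rw [mul_assoc, ih, Matrix.mul_smul, ← mul_assoc, cyclicBidiagonal_mul_diagonal h,
      Matrix.smul_mul, smul_smul, pow_succ, mul_assoc]

/-- Substituting `c X` for `X` multiplies the characteristic matrix by `c`. Comparing coefficients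
leaves a factor `c ^ a` to cancel, which is why `c` must be a unit. -/
theorem charpoly_smul_coeff (c : R) (hc : IsUnit c) (B : Matrix (Fin N) (Fin N) R) (a : ℕ)
    (ha : a ≤ N) : (c • B).charpoly.coeff a = c ^ (N - a) * B.charpoly.coeff a := by
  have h : (c • B).charpoly.comp (C c * X) = C (c ^ N) * B.charpoly := by
    rw [Matrix.charpoly, Matrix.charpoly, Polynomial.comp, ← coe_eval₂RingHom, RingHom.map_det]
    have : (eval₂RingHom C (C c * X)).mapMatrix (c • B).charmatrix = C c • B.charmatrix := by
      ext1 i j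
      by_cases hij : i = j
      · subst hij; simp [Matrix.charmatrix_apply_eq, mul_sub]
      · simp [Matrix.charmatrix_apply_ne _ _ _ hij]
    rw [this, Matrix.det_smul, Fintype.card_fin, C_pow]
  have h2 := congrArg (fun p => coeff p a) h
  simp only [comp_C_mul_X_coeff, coeff_C_mul] at h2
  apply (hc.pow a).mul_right_cancel
  rw [h2, mul_right_comm, ← pow_add, Nat.sub_add_cancel ha]

theorem cyclicProd_charpoly_coeff {z κ : R} (h : κ * z = 1) (ds : List (Fin N → R)) (y : R)
    (a : ℕ) (ha : a ≤ N) :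
    (cyclicProd ds y).charpoly.coeff a = z ^ (ds.length * (N - a)) *
      (cyclicProd (ds.map fun d i => κ * d i) (y * κ ^ N)).charpoly.coeff a := by
  have hz : IsUnit z := IsUnit.of_mul_eq_one κ (by rw [mul_comm, h])
  rw [pow_mul, ← charpoly_smul_coeff _ (hz.pow _) _ _ ha]
  congr 1
  set D : Matrix (Fin N) (Fin N) R := Matrix.diagonal fun i => z ^ (i : ℕ) with hD
  set D' : Matrix (Fin N) (Fin N) R := Matrix.diagonal fun i => κ ^ (i : ℕ) with hD'
  have h1 : D' * D = 1 := by
    rw [hD, hD', Matrix.diagonal_mul_diagonal]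
    simp [← mul_pow, h]
  have h2 : D * D' = 1 := by
    rw [hD, hD', Matrix.diagonal_mul_diagonal]
    simp [← mul_pow, mul_comm z κ, h]
  have h3 := cyclicProd_mul_diagonal h ds y
  calc (cyclicProd ds y).charpoly = (D * (D' * cyclicProd ds y)).charpoly := by
        rw [← mul_assoc, h2, one_mul]
    _ = _ := by
        rw [Matrix.charpoly_mul_comm, mul_assoc, h3, ← hD, Matrix.mul_smul, ← mul_assoc, h1,
          one_mul]

theorem cyclicBidiagonal_mulVec_apply_of_lt (d : Fin N → R) (y : R) (u : Fin N → R) (i : Fin N)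
    (h : (i : ℕ) + 1 < N) :
    (cyclicBidiagonal d y).mulVec u i = d i * u i + u ⟨i + 1, h⟩ := by
  rw [cyclicBidiagonal, Matrix.add_mulVec, Pi.add_apply, Matrix.mulVec_diagonal]
  congr 1
  rw [Matrix.mulVec, dotProduct, Finset.sum_eq_single ⟨i + 1, h⟩]
  · simp
  · intro j _ hj
    have : (i : ℕ) + 1 ≠ j := fun e => hj (Fin.ext e.symm)
    simp [this, h.ne]
  · simp

theorem cyclicBidiagonal_mulVec_apply_of_eq (d : Fin N → R) (y : R) (u : Fin N → R) (i : Fin N)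
    (h : (i : ℕ) + 1 = N) :
    (cyclicBidiagonal d y).mulVec u i = d i * u i + y * u ⟨0, by omega⟩ := by
  rw [cyclicBidiagonal, Matrix.add_mulVec, Pi.add_apply, Matrix.mulVec_diagonal]
  congr 1
  rw [Matrix.mulVec, dotProduct, Finset.sum_eq_single ⟨0, by omega⟩]
  · have h0 : N ≠ 0 := by omega
    simp [h, h0]
  · intro j _ hj
    have h0 : (j : ℕ) ≠ 0 := fun e => hj (Fin.ext e)
    have : (i : ℕ) + 1 ≠ j := by omega
    simp [this, h0]
  · simp

theorem cyclicProd_zero (ds : List (Fin N → R)) (hds : ∀ d ∈ ds, d = 0) (y : R) :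
    cyclicProd ds y = cyclicBidiagonal 0 y ^ ds.length := by
  rw [cyclicProd, List.prod_eq_pow_card _ (cyclicBidiagonal 0 y)]
  · simp
  · intro A hA
    obtain ⟨d, hd, rfl⟩ := List.mem_map.1 hA
    rw [hds d hd]

theorem cyclicBidiagonal_zero_mulVec_geom (ζ y : R) (hζ : ζ ^ N = y) :
    (cyclicBidiagonal 0 y).mulVec (fun i : Fin N => ζ ^ (i : ℕ)) =
      ζ • fun i : Fin N => ζ ^ (i : ℕ) := by
  funext i
  rcases (Nat.succ_le_of_lt i.2).lt_or_eq with h | h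
  · rw [cyclicBidiagonal_mulVec_apply_of_lt _ _ _ _ h]
    simp [pow_succ']
  · rw [cyclicBidiagonal_mulVec_apply_of_eq _ _ _ _ h]
    have h' : (i : ℕ) + 1 = N := h
    simp [← pow_succ', h', hζ]

theorem cyclicBidiagonal_zero_one_iterate (u : Fin N → R) (i : Fin N) (n : ℕ) :
    ((cyclicBidiagonal (0 : Fin N → R) 1) ^ n).mulVec u i =
      u ⟨(i + n) % N, Nat.mod_lt _ i.pos⟩ := by
  induction n generalizing i with
  | zero => simp [Nat.mod_eq_of_lt i.2]
  | succ n ih =>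
    rw [pow_succ', ← Matrix.mulVec_mulVec]
    rcases (Nat.succ_le_of_lt i.2).lt_or_eq with h | h
    · rw [cyclicBidiagonal_mulVec_apply_of_lt _ _ _ _ h]
      simp only [Pi.zero_apply, zero_mul, zero_add]
      rw [ih]
      refine congrArg u (Fin.ext ?_)
      simp [add_comm, add_left_comm]
    · rw [cyclicBidiagonal_mulVec_apply_of_eq _ _ _ _ h]
      have h' : (i : ℕ) + 1 = N := h
      simp only [Pi.zero_apply, zero_mul, zero_add, one_mul]
      rw [ih]
      refine congrArg u (Fin.ext ?_)
      change (0 + n) % N = (i + (n + 1)) % N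
      rw [zero_add, show (i : ℕ) + (n + 1) = n + N by omega, Nat.add_mod_right]

/-- The vector is invariant under the cyclic shift by `m`, which generates `ZMod N`. -/
theorem eq_of_cyclicBidiagonal_zero_one_pow_mulVec {m : ℕ} (hm : Nat.Coprime m N)
    (u : Fin N → R) (hu : ((cyclicBidiagonal (0 : Fin N → R) 1) ^ m).mulVec u = u)
    (i j : Fin N) : u i = u j := by
  have key : ∀ (n : ℕ) (i : Fin N), u ⟨(i + n * m) % N, Nat.mod_lt _ i.pos⟩ = u i := by
    intro n i
    rw [← cyclicBidiagonal_zero_one_iterate u i (n * m), mul_comm, pow_mul]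
    refine congrFun ?_ i
    induction n with
    | zero => simp
    | succ n ih => rw [pow_succ, ← Matrix.mulVec_mulVec, hu, ih]
  -- The natural number `N - i` stands for `-i` modulo `N`; thus `c` shifts by `m` lead from `i` to
  -- `j`.
  obtain ⟨c, hc⟩ : ∃ c, (c * m) % N = ((j : ℕ) + (N - i)) % N := by
    have hN : 0 < N := i.pos
    have : NeZero N := ⟨hN.ne'⟩
    refine ⟨(((ZMod.unitOfCoprime m hm)⁻¹ : (ZMod N)ˣ) * ((j : ℕ) + (N - i) : ℕ) : ZMod N).val, ?_⟩
    have : ((((((ZMod.unitOfCoprime m hm)⁻¹ : (ZMod N)ˣ) * ((j : ℕ) + (N - i) : ℕ) : ZMod N).val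
      * m : ℕ)) : ZMod N) = ((j : ℕ) + (N - i) : ℕ) := by
      rw [Nat.cast_mul, ZMod.natCast_zmod_val, mul_right_comm, ← ZMod.coe_unitOfCoprime m hm,
        Units.inv_mul, one_mul]
    exact (ZMod.natCast_eq_natCast_iff' _ _ _).1 this
  rw [← key c i]
  congr 1
  apply Fin.ext
  simp only
  rw [Nat.add_mod, hc, ← Nat.add_mod, show (i : ℕ) + (j + (N - i)) = j + N by omega,
    Nat.add_mod_right, Nat.mod_eq_of_lt j.2]

/-- The geometric vectors of the `N`-th roots of unity are eigenvectors, with the `m`-th powers of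
the roots as eigenvalues. As `m` is prime to `N`, these exhaust the roots of unity, and two monic
polynomials of degree `N` with `N` common zeros agree. -/
theorem charpoly_cyclicBidiagonal_zero_one_pow (hN : 0 < N) {m : ℕ} (hm : Nat.Coprime m N) :
    ((cyclicBidiagonal (0 : Fin N → ℂ) 1) ^ m).charpoly = X ^ N - 1 := by
  have : NeZero N := ⟨hN.ne'⟩
  set B := (cyclicBidiagonal (0 : Fin N → ℂ) 1) ^ m with hB
  have hprim := Complex.isPrimitiveRoot_exp N hN.ne'
  set ζ := Complex.exp (2 * Real.pi * Complex.I / N) with hζ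
  have hcard : (nthRootsFinset N (1 : ℂ)).card = N := hprim.card_nthRootsFinset
  refine eq_of_degree_sub_lt_of_eval_finset_eq (nthRootsFinset N (1 : ℂ)) ?_ ?_
  · rw [hcard]
    have h1 : B.charpoly.degree = N := by simp [Matrix.charpoly_degree_eq_dim]
    have h2 : (X ^ N - 1 : ℂ[X]).degree = N := by
      simpa using degree_X_pow_sub_C hN (1 : ℂ)
    rw [← h1]
    refine degree_sub_lt_left (h1.trans h2.symm) B.charpoly_monic.ne_zero ?_
    rw [B.charpoly_monic.leadingCoeff, show (X ^ N - 1 : ℂ[X]).leadingCoeff = 1 by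
      simpa using leadingCoeff_X_pow_sub_C hN (r := (1 : ℂ))]
  · intro x hx
    rw [mem_nthRootsFinset hN] at hx
    simp only [eval_sub, eval_pow, eval_X, eval_one, hx, sub_self]
    have hpm := hprim.pow_of_coprime m hm
    obtain ⟨j, -, rfl⟩ := hpm.eq_pow_of_pow_eq_one hx
    have hv := cyclicBidiagonal_zero_mulVec_geom (N := N) (ζ ^ j) 1
      (by rw [← pow_mul, mul_comm, pow_mul, hprim.pow_eq_one, one_pow])
    have hv2 : ∀ n, ((cyclicBidiagonal (0 : Fin N → ℂ) 1) ^ n).mulVec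
        (fun i : Fin N => (ζ ^ j) ^ (i : ℕ)) = (ζ ^ j) ^ n • fun i : Fin N => (ζ ^ j) ^ (i : ℕ) := by
      intro n
      induction n with
      | zero => simp
      | succ n ih => rw [pow_succ, ← Matrix.mulVec_mulVec, hv, Matrix.mulVec_smul, ih, smul_smul,
          pow_succ' (ζ ^ j)]
    rw [Matrix.eval_charpoly]
    rw [← Matrix.exists_mulVec_eq_zero_iff]
    refine ⟨fun i : Fin N => (ζ ^ j) ^ (i : ℕ), ?_, ?_⟩
    · intro h0
      simpa using congrFun h0 ⟨0, hN⟩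
    · rw [Matrix.sub_mulVec, hv2 m]
      ext i
      simp [Matrix.scalar_apply, ← pow_mul, mul_comm]

theorem det_cyclicBidiagonal (d : Fin N → R) (y : R) (hN : 0 < N) :
    (cyclicBidiagonal d y).det = ∏ i, d i - (-1) ^ N * y := by
  obtain ⟨n, rfl⟩ : ∃ n, N = n + 1 := ⟨N - 1, by omega⟩
  rcases n.eq_zero_or_pos with rfl | hn
  · simp [cyclicBidiagonal]
  rw [Matrix.det_succ_column_zero]
  have hz : (0 : Fin (n + 1)) ≠ Fin.last n := by
    intro h; have := congrArg Fin.val h; simp at this; omega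
  rw [Finset.sum_eq_add (0 : Fin (n + 1)) (Fin.last n) hz]
  · have h1 : ((cyclicBidiagonal d y).submatrix (Fin.succAbove 0) Fin.succ).det =
        ∏ i : Fin n, d i.succ := by
      rw [Matrix.det_of_isUpperTriangular]
      · apply Finset.prod_congr rfl
        intro i _
        simp [cyclicBidiagonal]
      · intro i j hij
        have hij' : j < i := hij
        have : (i : ℕ) + 1 ≠ j := by omega
        simp [cyclicBidiagonal, hij'.ne', this]
    have h2 : ((cyclicBidiagonal d y).submatrix (Fin.succAbove (Fin.last n)) Fin.succ).det = 1 := by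
      rw [Matrix.det_of_isLowerTriangular]
      · apply Finset.prod_eq_one
        intro i _
        rw [Matrix.submatrix_apply, cyclicBidiagonal, Matrix.add_apply,
          Matrix.diagonal_apply_ne _ (by simp [Fin.ext_iff])]
        simp
      · intro i j hij
        have hij' : i < j := hij
        have : (i : ℕ) ≠ j := by omega
        have h3 : (i : ℕ) ≠ j + 1 := by omega
        rw [Matrix.submatrix_apply, cyclicBidiagonal, Matrix.add_apply,
          Matrix.diagonal_apply_ne _ (by simp [Fin.ext_iff]; omega)]
        simp [this]
    rw [h1, h2, Fin.prod_univ_succ]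
    simp [cyclicBidiagonal, hz.symm, pow_succ]
    rw [if_neg (by omega)]
    ring
  · intro c _ hc
    have h1 : (c : ℕ) ≠ n := fun h => hc.2 (Fin.ext h)
    simp [cyclicBidiagonal, hc.1, h1]
  · simp
  · simp

theorem det_cyclicProd (ds : List (Fin N → R)) (y : R) (hN : 0 < N) :
    (cyclicProd ds y).det = (ds.map fun d => ∏ i, d i - (-1) ^ N * y).prod := by
  rw [cyclicProd, ← Matrix.coe_detMonoidHom, map_list_prod, List.map_map]
  congr 2
  funext d
  exact det_cyclicBidiagonal d y hN

theorem cyclicProd_zero_right (ds : List (Fin N → R)) :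
    (cyclicProd ds 0).BlockTriangular id ∧
      ∀ i, cyclicProd ds 0 i i = (ds.map fun d => d i).prod := by
  induction ds with
  | nil => simpa [cyclicProd] using Matrix.blockTriangular_one
  | cons d ds ih =>
    have hd : (cyclicBidiagonal d 0).BlockTriangular id := by
      intro i j hij
      have hij' : j < i := hij
      have : (i : ℕ) + 1 ≠ j := by omega
      simp [cyclicBidiagonal, hij'.ne', this]
    have e : cyclicProd (d :: ds) 0 = cyclicBidiagonal d 0 * cyclicProd ds 0 := by
      simp [cyclicProd]
    rw [e]
    refine ⟨hd.mul ih.1, fun i => ?_⟩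
    rw [Matrix.mul_apply, Finset.sum_eq_single i]
    · rw [ih.2, List.map_cons, List.prod_cons]
      simp [cyclicBidiagonal]
    · intro j _ hj
      rcases lt_or_gt_of_ne hj with h | h
      · rw [hd h, zero_mul]
      · rw [ih.1 h, mul_zero]
    · simp

theorem charpoly_cyclicProd_zero_right (ds : List (Fin N → R)) :
    (cyclicProd ds 0).charpoly = ∏ i, (X - C ((ds.map fun d => d i).prod)) := by
  rw [Matrix.charpoly_of_isUpperTriangular _ (cyclicProd_zero_right ds).1]
  simp [(cyclicProd_zero_right ds).2]

end CyclicBidiagonal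

/-! ### Time independence of the spectral curve. -/

section Isospectral

section Monoid

variable {G : Type*} [Monoid G] {L R : ℤ → G} {M K : ℤ}

/-- Passing one `R` delays `L` by `K`, which is exactly the delay of the next `R`, so the
commutation relation applies again. -/
theorem mul_prod_range_map_of_commutation (h : ∀ t, L t * R t = R (t - M) * L (t - K))
    (n : ℕ) (t : ℤ) :
    L t * ((List.range n).map fun j : ℕ => R (t - j * K)).prod =
      ((List.range n).map fun j : ℕ => R (t - M - j * K)).prod * L (t - n * K) := by
  induction n with
  | zero => simp
  | succ n ih =>
    rw [List.range_succ, List.map_append, List.map_append, List.prod_append, List.prod_append,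
      ← mul_assoc, ih, mul_assoc, mul_assoc]
    simp only [List.map_cons, List.map_nil, List.prod_singleton]
    rw [h]
    congr 3 <;> push_cast <;> ring

theorem prod_reverse_range_map_mul_of_commutation (h : ∀ t, L t * R t = R (t - M) * L (t - K))
    (n : ℕ) (t : ℤ) :
    ((List.range n).reverse.map fun j : ℕ => L (t - j * M)).prod * R t =
      R (t - n * M) * ((List.range n).reverse.map fun j : ℕ => L (t - K - j * M)).prod := by
  induction n with
  | zero => simp
  | succ n ih =>
    simp only [List.range_succ, List.reverse_append, List.reverse_singleton, List.singleton_append,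
      List.map_cons, List.prod_cons]
    rw [mul_assoc, ih, ← mul_assoc, h, mul_assoc]
    congr 2
    · push_cast; ring
    · congr 1; ring

end Monoid

variable {M K N : ℕ} {I V : ℤ → ℤ → ℂ}

theorem IsSolution.mul_eq_mul (h : IsSolution M K N I V) (n t : ℤ) :
    V n t * I n t = I n (t - M) * V n (t - K) := by
  rw [h.eq_V n t, div_mul_cancel₀ _ (h.I_ne_zero n t)]

/-- Expanded in powers of the shift matrix, the quadratic terms agree, the linear ones are `eq_I`
and the constant ones are `eq_V`. At the corner entry `eq_I` is used across the period. -/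
theorem IsSolution.bidiagonal_commutation (h : IsSolution M K N I V) (t : ℤ) :
    (bidiagonal N fun n => V n t) * (bidiagonal N fun n => I n t) =
      (bidiagonal N fun n => I n (t - M)) * (bidiagonal N fun n => V n (t - K)) := by
  have hs : ∀ n, V n t + I (n + 1) t = I n (t - M) + V (n + 1) (t - K) := by
    intro n
    rw [h.eq_I (n + 1) t, add_sub_cancel_right]
    ring
  have hS : Matrix.diagonal (fun i : Fin N => C (V ((i : ℤ) + 1) t)) * shiftMatrix N +
      shiftMatrix N * Matrix.diagonal (fun i : Fin N => C (I ((i : ℤ) + 1) t)) =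
      Matrix.diagonal (fun i : Fin N => C (I ((i : ℤ) + 1) (t - M))) * shiftMatrix N +
      shiftMatrix N * Matrix.diagonal (fun i : Fin N => C (V ((i : ℤ) + 1) (t - K))) := by
    ext1 i j
    simp only [Matrix.add_apply, Matrix.diagonal_mul, Matrix.mul_diagonal]
    rw [mul_comm (shiftMatrix N i j), mul_comm (shiftMatrix N i j), ← add_mul, ← add_mul,
      ← C_add, ← C_add]
    by_cases h1 : (i : ℕ) + 1 = j
    · have h2 : (j : ℤ) = (i : ℤ) + 1 := by exact_mod_cast h1.symm
      rw [h2, hs]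
    by_cases h2 : (i : ℕ) + 1 = N ∧ (j : ℕ) = 0
    · have h3 : (i : ℤ) + 1 = N := by exact_mod_cast h2.1
      have h4 := hs N
      have h5 := h.I_periodic 1 t
      have h6 := h.V_periodic 1 (t - K)
      rw [add_comm] at h5 h6
      rw [h5, h6] at h4
      rw [h3, h2.2, Nat.cast_zero, zero_add, h4]
    · simp [shiftMatrix, h1, h2]
  have hd : Matrix.diagonal (fun i : Fin N => C (V ((i : ℤ) + 1) t)) *
      Matrix.diagonal (fun i : Fin N => C (I ((i : ℤ) + 1) t)) =
      Matrix.diagonal (fun i : Fin N => C (I ((i : ℤ) + 1) (t - M))) *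
      Matrix.diagonal (fun i : Fin N => C (V ((i : ℤ) + 1) (t - K))) := by
    simp only [Matrix.diagonal_mul_diagonal, ← C_mul, h.mul_eq_mul]
  simp only [bidiagonal, add_mul, mul_add]
  rw [hd, add_assoc, add_assoc, add_left_cancel_iff, ← add_assoc, ← add_assoc, add_right_cancel_iff,
    add_comm, hS, add_comm]

/-- Carrying `L_t` through all the `R` factors turns it into `L_{t-KM}`. A cyclic permutation brings
it to the front, where it is the missing first factor of `X_{t-M}`. -/
theorem IsSolution.spectralPoly_sub_M (h : IsSolution M K N I V) (hK : 0 < K) (t : ℤ) :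
    spectralPoly M K N I V (t - M) = spectralPoly M K N I V t := by
  obtain ⟨k, rfl⟩ : ∃ k, K = k + 1 := ⟨K - 1, by omega⟩
  have hc := h.bidiagonal_commutation
  set L : ℤ → Matrix (Fin N) (Fin N) ℂ[X] := fun t => bidiagonal N fun n => V n t with hL
  set R : ℤ → Matrix (Fin N) (Fin N) ℂ[X] := fun t => bidiagonal N fun n => I n t with hR
  have h1 := mul_prod_range_map_of_commutation (L := L) (R := R) hc M t
  have e1 : ((List.range (k + 1)).reverse.map fun j : ℕ => L (t - j * M)).prod =
      ((List.range k).reverse.map fun j : ℕ => L (t - M - j * M)).prod * L t := by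
    rw [List.range_succ_eq_map, List.reverse_cons, List.map_append, List.prod_append,
      ← List.map_reverse, List.map_map]
    simp only [List.map_cons, List.map_nil, List.prod_singleton, Nat.cast_zero, zero_mul, sub_zero]
    congr 3
    funext j
    simp only [Function.comp]
    congr 1
    push_cast; ring
  have e2 : ((List.range (k + 1)).reverse.map fun j : ℕ => L (t - M - j * M)).prod =
      L (t - M - k * M) * ((List.range k).reverse.map fun j : ℕ => L (t - M - j * M)).prod := by
    simp [List.range_succ]
  rw [spectralPoly, spectralPoly, laxMatrix, laxMatrix]
  change (((List.range (k + 1)).reverse.map fun j : ℕ => L (t - M - j * M)).prod *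
      ((List.range M).map fun j : ℕ => R (t - M - j * (k + 1 : ℕ))).prod).charpoly =
    (((List.range (k + 1)).reverse.map fun j : ℕ => L (t - j * M)).prod *
      ((List.range M).map fun j : ℕ => R (t - j * (k + 1 : ℕ))).prod).charpoly
  rw [e1, e2, mul_assoc, mul_assoc, h1, Matrix.charpoly_mul_comm, mul_assoc]
  congr 4
  push_cast; ring

theorem IsSolution.spectralPoly_sub_K (h : IsSolution M K N I V) (hM : 0 < M) (t : ℤ) :
    spectralPoly M K N I V (t - K) = spectralPoly M K N I V t := by
  obtain ⟨m, rfl⟩ : ∃ m, M = m + 1 := ⟨M - 1, by omega⟩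
  have hc := h.bidiagonal_commutation
  set L : ℤ → Matrix (Fin N) (Fin N) ℂ[X] := fun t => bidiagonal N fun n => V n t with hL
  set R : ℤ → Matrix (Fin N) (Fin N) ℂ[X] := fun t => bidiagonal N fun n => I n t with hR
  have h1 := prod_reverse_range_map_mul_of_commutation (L := L) (R := R) hc K t
  have e1 : ((List.range (m + 1)).map fun j : ℕ => R (t - j * K)).prod =
      R t * ((List.range m).map fun j : ℕ => R (t - K - j * K)).prod := by
    rw [List.range_succ_eq_map, List.map_cons, List.prod_cons, List.map_map]
    simp only [Nat.cast_zero, zero_mul, sub_zero]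
    congr 3
    funext j
    simp only [Function.comp]
    congr 1
    push_cast; ring
  have e2 : ((List.range (m + 1)).map fun j : ℕ => R (t - K - j * K)).prod =
      ((List.range m).map fun j : ℕ => R (t - K - j * K)).prod * R (t - K - m * K) := by
    simp [List.range_succ]
  rw [spectralPoly, spectralPoly, laxMatrix, laxMatrix]
  change (((List.range K).reverse.map fun j : ℕ => L (t - K - j * (m + 1 : ℕ))).prod *
      ((List.range (m + 1)).map fun j : ℕ => R (t - K - j * K)).prod).charpoly =
    (((List.range K).reverse.map fun j : ℕ => L (t - j * (m + 1 : ℕ))).prod *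
      ((List.range (m + 1)).map fun j : ℕ => R (t - j * K)).prod).charpoly
  rw [e1, e2, ← mul_assoc, ← mul_assoc, h1, Matrix.charpoly_mul_comm, mul_assoc]
  congr 3
  push_cast; ring

theorem eq_of_sub_invariant {α : Type*} (f : ℤ → α) (hMK : Nat.Coprime M K)
    (hM : ∀ t, f (t - M) = f t) (hK : ∀ t, f (t - K) = f t) (s t : ℤ) : f s = f t := by
  have h1 : Function.Periodic f (M : ℤ) := fun t => by rw [← hM, add_sub_cancel_right]
  have h2 : Function.Periodic f (K : ℤ) := fun t => by rw [← hK, add_sub_cancel_right]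
  obtain ⟨a, b, hab⟩ := Nat.isCoprime_iff_coprime.2 hMK
  have h3 : Function.Periodic f 1 := by
    rw [← hab]
    exact (h1.int_mul a).add_period (h2.int_mul b)
  have := (h3.int_mul (s - t)) t
  simpa using this

theorem IsSolution.spectralPoly_eq (h : IsSolution M K N I V) (hM : 0 < M) (hK : 0 < K)
    (hMK : Nat.Coprime M K) (s t : ℤ) : spectralPoly M K N I V s = spectralPoly M K N I V t :=
  eq_of_sub_invariant _ hMK (h.spectralPoly_sub_M hK) (h.spectralPoly_sub_K hM) s t

end Isospectral

/-! ### Independence of time of the products `U_j`. -/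

section ConservedProducts

/-- Euclid's algorithm on the exponents: `[m + l] = X ^ m [l] + [m]`, and `X` is invertible modulo
`[m]`. A Bézout relation over `ℤ` is obtained, although `ℤ[X]` is not a principal ideal domain. -/
theorem isCoprime_geom_sum_X {m n : ℕ} (h : Nat.Coprime m n) :
    IsCoprime (∑ i ∈ Finset.range m, (X : ℤ[X]) ^ i) (∑ i ∈ Finset.range n, X ^ i) := by
  have hX : ∀ m, 0 < m → IsCoprime (∑ i ∈ Finset.range m, (X : ℤ[X]) ^ i) X := by
    intro m hm
    obtain ⟨k, rfl⟩ : ∃ k, m = k + 1 := ⟨m - 1, by omega⟩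
    rw [geom_sum_succ]
    exact ⟨1, -∑ i ∈ Finset.range k, X ^ i, by ring⟩
  have hadd : ∀ m n, (∑ i ∈ Finset.range (m + n), (X : ℤ[X]) ^ i) =
      X ^ m * ∑ i ∈ Finset.range n, X ^ i + ∑ i ∈ Finset.range m, X ^ i := by
    intro m n
    rw [Finset.sum_range_add, add_comm, Finset.mul_sum]
    simp [pow_add]
  induction hk : m + n using Nat.strong_induction_on generalizing m n with
  | _ k ih =>
    wlog hmn : m ≤ n generalizing m n
    · exact (this h.symm (by omega) (by omega)).symm
    rcases m.eq_zero_or_pos with rfl | hm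
    · rw [Nat.coprime_zero_left] at h
      subst h
      simp [isCoprime_one_right]
    · obtain ⟨l, rfl⟩ := Nat.exists_eq_add_of_le hmn
      have hl : Nat.Coprime m l := by simpa using h
      have h1 := ih (m + l) (by omega) hl rfl
      rw [hadd]
      have h2 := ((hX m hm).pow_right (n := m)).mul_right h1
      simpa using h2.add_mul_left_right 1

/-- The backward shift of functions on `ℤ`. -/
def backShift (G : Type*) [AddCommGroup G] : Module.End ℤ (ℤ → G) :=
  LinearMap.funLeft ℤ G fun t => t - 1

theorem backShift_pow_apply {G : Type*} [AddCommGroup G] (n : ℕ) (f : ℤ → G) (t : ℤ) :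
    (backShift G ^ n) f t = f (t - n) := by
  induction n generalizing t with
  | zero => simp
  | succ n ih =>
    rw [pow_succ', Module.End.mul_apply]
    change ((backShift G ^ n) f) (t - 1) = _
    rw [ih]
    congr 1; push_cast; ring

theorem aeval_backShift_sum {G : Type*} [AddCommGroup G] (n c : ℕ) (f : ℤ → G) (t : ℤ) :
    aeval (backShift G) (∑ i ∈ Finset.range n, ((X : ℤ[X]) ^ c) ^ i) f t =
      ∑ i ∈ Finset.range n, f (t - i * c) := by
  simp only [map_sum, map_pow, aeval_X, LinearMap.sum_apply, Finset.sum_apply, ← pow_mul,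
    backShift_pow_apply]
  refine Finset.sum_congr rfl fun i _ => ?_
  congr 1; push_cast; ring

/-- Let `T` be the backward shift. The hypothesis reads `(T - 1) W = 0` for `W = a(T) f + b(T) g`,
so `W` is constant. Since `A b = a B` with `a` and `b` coprime, `A = a A'` and `B = b A'`; hence
`A(T) f + B(T) g = A'(T) W = A'(1) W = W`. -/
theorem sum_range_add_sum_range_eq {G : Type*} [AddCommGroup G] {M K : ℕ} (hK : 0 < K)
    (hMK : Nat.Coprime M K) (f g : ℤ → G) (h : ∀ t, f t + g t = g (t - M) + f (t - K)) (s t : ℤ) :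
    ∑ j ∈ Finset.range K, f (t - j * M) + ∑ j ∈ Finset.range M, g (t - j * K) =
      ∑ j ∈ Finset.range K, f (s - j) + ∑ j ∈ Finset.range M, g (s - j) := by
  set T := backShift G with hT
  set a : ℤ[X] := ∑ i ∈ Finset.range K, X ^ i with ha
  set b : ℤ[X] := ∑ i ∈ Finset.range M, X ^ i with hb
  set A : ℤ[X] := ∑ i ∈ Finset.range K, (X ^ M) ^ i with hA
  set B : ℤ[X] := ∑ i ∈ Finset.range M, (X ^ K) ^ i with hB
  have hX1 : (X - 1 : ℤ[X]) ≠ 0 := by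
    simpa using X_sub_C_ne_zero (1 : ℤ)
  have ha1 : a * (X - 1) = X ^ K - 1 := geom_sum_mul _ _
  have hb1 : b * (X - 1) = X ^ M - 1 := geom_sum_mul _ _
  have hA1 : A * (X ^ M - 1) = (X ^ M) ^ K - 1 := geom_sum_mul _ _
  have hB1 : B * (X ^ K - 1) = (X ^ K) ^ M - 1 := geom_sum_mul _ _
  have hab : A * b = a * B := by
    apply mul_right_cancel₀ hX1
    rw [mul_assoc, hb1, hA1, mul_right_comm, ha1, mul_comm, hB1, ← pow_mul, ← pow_mul, mul_comm]
  have haK : a.eval 1 = K := by simp [ha, eval_finsetSum]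
  have ha0 : a ≠ 0 := by
    intro h0
    rw [h0, eval_zero] at haK
    exact hK.ne (by exact_mod_cast haK)
  obtain ⟨A', hA'⟩ : a ∣ A :=
    (isCoprime_geom_sum_X hMK.symm).dvd_of_dvd_mul_right ⟨B, hab⟩
  have hB' : B = b * A' := by
    apply mul_left_cancel₀ ha0
    rw [← hab, hA']; ring
  -- Both `A` and `a` take the value `K` at `1`. The hypothesis `0 < K` permits the cancellation.
  have hA'1 : A'.eval 1 = 1 := by
    have h1 : A.eval 1 = K := by simp [hA, eval_finsetSum]
    rw [hA', eval_mul, haK] at h1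
    have : (K : ℤ) ≠ 0 := by exact_mod_cast hK.ne'
    exact mul_left_cancel₀ this (by rw [h1, mul_one])
  obtain ⟨c, hc⟩ : (X - C 1 : ℤ[X]) ∣ A' - C (A'.eval 1) := X_sub_C_dvd_sub_C_eval
  rw [hA'1] at hc
  set W := aeval T a f + aeval T b g with hW
  have hTW : aeval T (X - C 1 : ℤ[X]) W = 0 := by
    rw [hW, map_add, ← Module.End.mul_apply, ← Module.End.mul_apply, ← map_mul, ← map_mul, C_1,
      mul_comm, ha1, mul_comm, hb1]
    funext t
    simp only [map_sub, map_pow, aeval_X, map_one, Pi.add_apply, LinearMap.sub_apply,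
      Module.End.one_apply, Pi.sub_apply, hT, backShift_pow_apply, Pi.zero_apply]
    rw [sub_add_sub_comm, add_comm (f _) (g _), ← h t, sub_self]
  have hA'W : aeval T A' W = W := by
    have hA'c : A' = 1 + c * (X - C 1) := by rw [mul_comm, ← hc, C_1]; ring
    have h1 : aeval T A' = 1 + aeval T c * aeval T (X - C 1 : ℤ[X]) := by
      rw [hA'c, map_add, map_mul, map_one]
    rw [h1, LinearMap.add_apply, Module.End.mul_apply, hTW, map_zero, add_zero,
      Module.End.one_apply]
  have hWt : ∀ t, W t = ∑ j ∈ Finset.range K, f (t - j) + ∑ j ∈ Finset.range M, g (t - j) := by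
    intro t
    have h1 := aeval_backShift_sum K 1 f t
    have h2 := aeval_backShift_sum M 1 g t
    simp only [pow_one, Nat.cast_one, mul_one] at h1 h2
    rw [hW, Pi.add_apply, h1, h2]
  have hWc : ∀ t, W (t - 1) = W t := by
    intro t
    have := congrFun hTW t
    simp only [map_sub, aeval_X, LinearMap.sub_apply, Pi.sub_apply, Pi.zero_apply, map_one,
      Module.End.one_apply, sub_eq_zero] at this
    exact this
  have hconst : W t = W s :=
    eq_of_sub_invariant (M := 1) (K := 1) W (by simp) (by simpa using hWc) (by simpa using hWc) t s
  have hfin : W = aeval T A f + aeval T B g := by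
    rw [hA', hB', mul_comm a, mul_comm b, map_mul, map_mul, Module.End.mul_apply,
      Module.End.mul_apply, ← map_add, ← hW, hA'W]
  rw [← hWt, ← hconst, hfin, Pi.add_apply, aeval_backShift_sum, aeval_backShift_sum]

/-- If no `v t` vanishes, this is the additive statement in the group `ℂˣ`. Otherwise the zeros of
`v` are `K`-periodic in time, and both `j * M` and `j` run through all residues modulo `K`, so both
sides vanish. -/
theorem prod_range_mul_prod_range_eq {M K : ℕ} (hK : 0 < K)
    (hMK : Nat.Coprime M K) (v i : ℤ → ℂ) (hi : ∀ t, i t ≠ 0)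
    (h : ∀ t, v t * i t = i (t - M) * v (t - K)) (s t : ℤ) :
    (∏ j ∈ Finset.range K, v (t - j * M)) * ∏ j ∈ Finset.range M, i (t - j * K) =
      (∏ j ∈ Finset.range K, v (s - j)) * ∏ j ∈ Finset.range M, i (s - j) := by
  by_cases hv : ∀ t, v t ≠ 0
  · have := sum_range_add_sum_range_eq (G := Additive ℂˣ) hK hMK
      (fun t => Additive.ofMul (Units.mk0 (v t) (hv t)))
      (fun t => Additive.ofMul (Units.mk0 (i t) (hi t)))
      (fun t => by
        rw [← ofMul_mul, ← ofMul_mul]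
        congr 1
        ext
        exact h t) s t
    have := congrArg (fun x => ((Additive.toMul x : ℂˣ) : ℂ)) this
    simpa [← ofMul_prod, Units.coe_prod] using this
  · push Not at hv
    obtain ⟨t₀, ht₀⟩ := hv
    have hper : ∀ t, (v (t - K) = 0) = (v t = 0) := by
      intro t
      have := h t
      refine propext ⟨fun h0 => ?_, fun h0 => ?_⟩
      · rw [h0, mul_zero] at this
        exact (mul_eq_zero.1 this).resolve_right (hi t)
      · rw [h0, zero_mul] at this
        exact (mul_eq_zero.1 this.symm).resolve_left (hi _)
    have hP : Function.Periodic (fun t => v t = 0) (K : ℤ) := fun t => by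
      have := hper (t + K)
      rw [add_sub_cancel_right] at this
      exact this.symm
    have hmod : ∀ t, (K : ℤ) ∣ t - t₀ → v t = 0 := by
      rintro t ⟨c, hc⟩
      have := (hP.int_mul c) t₀
      rw [mul_comm] at this
      change (v (t₀ + K * c) = 0) = (v t₀ = 0) at this
      rw [← hc, add_sub_cancel] at this
      rw [this]; exact ht₀
    have hfind : ∀ (c : ℕ), Nat.Coprime c K → ∀ t : ℤ, ∃ j ∈ Finset.range K,
        v (t - j * c) = 0 := by
      intro c hc t
      have : NeZero K := ⟨hK.ne'⟩
      refine ⟨(((ZMod.unitOfCoprime c hc)⁻¹ : (ZMod K)ˣ) * ((t - t₀ : ℤ) : ZMod K) : ZMod K).val,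
        Finset.mem_range.2 (ZMod.val_lt _), hmod _ ?_⟩
      rw [← ZMod.intCast_zmod_eq_zero_iff_dvd]
      push_cast
      rw [ZMod.natCast_zmod_val, mul_right_comm, ← ZMod.coe_unitOfCoprime c hc,
        Units.inv_mul, one_mul]
      ring
    obtain ⟨j, hj, h1⟩ := hfind M hMK t
    obtain ⟨l, hl, h2⟩ := hfind 1 (by simp) s
    rw [Finset.prod_eq_zero hj h1, Finset.prod_eq_zero hl (by simpa using h2), zero_mul, zero_mul]

end ConservedProducts

/-! ### The Lax matrix as a product of cyclic bidiagonal matrices. -/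

section LaxDiagonals

variable {M K N : ℕ} {I V : ℤ → ℤ → ℂ}

/-- The diagonals of the factors of the Lax matrix, in order. -/
def laxDiagonals (M K N : ℕ) (I V : ℤ → ℤ → ℂ) (t : ℤ) : List (Fin N → ℂ) :=
  ((List.range K).reverse.map fun (j : ℕ) (i : Fin N) => V ((i : ℤ) + 1) (t - j * M)) ++
    (List.range M).map fun (j : ℕ) (i : Fin N) => I ((i : ℤ) + 1) (t - j * K)

theorem length_laxDiagonals (t : ℤ) : (laxDiagonals M K N I V t).length = M + K := by
  simp [laxDiagonals, add_comm]

theorem laxMatrix_eq_cyclicProd (t : ℤ) : laxMatrix M K N I V t =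
    cyclicProd ((laxDiagonals M K N I V t).map fun d i => C (d i)) X := by
  have hb : ∀ d : ℤ → ℂ, bidiagonal N d =
      cyclicBidiagonal (fun i : Fin N => C (d ((i : ℤ) + 1))) X := fun _ => rfl
  simp only [laxMatrix, hb, cyclicProd, laxDiagonals, List.map_append, List.prod_append,
    List.map_map]
  rfl

theorem IsSolution.prod_laxDiagonals (h : IsSolution M K N I V) (hK : 0 < K)
    (hMK : Nat.Coprime M K) (t s : ℤ) (j : Fin N) :
    ((laxDiagonals M K N I V t).map fun d => d j).prod =
      (∏ k ∈ Finset.Icc 1 K, V ((j : ℤ) + 1) (s - (k : ℕ))) *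
        ∏ k ∈ Finset.Icc 1 M, I ((j : ℤ) + 1) (s - (k : ℕ)) := by
  have hI : ∀ (n : ℕ) (f : ℤ → ℂ), ∏ k ∈ Finset.Icc 1 n, f (s - (k : ℕ)) =
      ∏ j ∈ Finset.range n, f (s - 1 - j) := by
    intro n f
    rw [Finset.range_eq_Ico, Finset.prod_Ico_add' (fun j : ℕ => f (s - (j : ℕ))) 0 n 1 |>.symm.trans
      (Finset.prod_congr rfl fun j _ => by push_cast; congr 1; ring) |>.symm]
    rfl
  -- The delays in the goal start at `1` instead of `0`, hence the base time `s - 1`.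
  rw [hI, hI, ← prod_range_mul_prod_range_eq hK hMK _ _ (h.I_ne_zero _) (h.mul_eq_mul _) (s - 1) t,
    laxDiagonals, List.map_append, List.prod_append, List.map_map, List.map_map,
    List.map_reverse, List.prod_reverse]
  rfl

end LaxDiagonals

/-! ### The Newton polygon of the curve. -/

section Weights

variable {N : ℕ}

/-- The characteristic polynomial of the product of the matrices `diag(d) + S(y)`, where `d` runs
through a list. -/
def cyclicCurve (ds : List (Fin N → ℂ)) : ℂ[X][X] :=
  (cyclicProd (ds.map fun d i => C (d i)) X).charpoly

/-- The equation of the curve `cyclicCurve ds` near infinity: the characteristic polynomial of the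
product of the matrices `κ • diag(d) + S(1)`, where the inner variable is `κ`. -/
def cyclicCurveInfty (ds : List (Fin N → ℂ)) : ℂ[X][X] :=
  (cyclicProd (ds.map fun d i => X * C (d i)) 1).charpoly

theorem spectralPoly_eq_cyclicCurve (M K N : ℕ) (I V : ℤ → ℤ → ℂ) (t : ℤ) :
    spectralPoly M K N I V t = cyclicCurve (laxDiagonals M K N I V t) := by
  rw [spectralPoly, laxMatrix_eq_cyclicProd, cyclicCurve]

theorem cyclicCurve_monic (ds : List (Fin N → ℂ)) : (cyclicCurve ds).Monic :=
  Matrix.charpoly_monic _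

theorem cyclicCurve_natDegree (ds : List (Fin N → ℂ)) : (cyclicCurve ds).natDegree = N := by
  rw [cyclicCurve, Matrix.charpoly_natDegree_eq_dim, Fintype.card_fin]

/-- For `y = z ^ N` the rescaled corner entry `y * κ ^ N` is `1`: this is the change of coordinates
`x = z ^ m ξ` between the curve and its chart at infinity. -/
theorem aeval_coeff_cyclicCurve {R : Type*} [CommRing R] [Algebra ℂ R] {z κ : R} (h : κ * z = 1)
    (ds : List (Fin N → ℂ)) (a : ℕ) (ha : a ≤ N) :
    aeval (z ^ N) ((cyclicCurve ds).coeff a) =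
      z ^ (ds.length * (N - a)) * aeval κ ((cyclicCurveInfty ds).coeff a) := by
  have h1 := cyclicProd_charpoly_coeff h (ds.map fun d i => algebraMap ℂ R (d i)) (z ^ N) a ha
  have e1 : aeval (z ^ N) ((cyclicCurve ds).coeff a) =
      (cyclicProd (ds.map fun d i => algebraMap ℂ R (d i)) (z ^ N)).charpoly.coeff a := by
    change (aeval (z ^ N) : ℂ[X] →ₐ[ℂ] R).toRingHom _ = _
    rw [← coeff_map, cyclicCurve, ← Matrix.charpoly_map, cyclicProd_map, List.map_map]
    congr 3
    · refine List.map_congr_left fun d _ => funext fun i => ?_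
      simp
    · simp
  have e2 : aeval κ ((cyclicCurveInfty ds).coeff a) =
      (cyclicProd ((ds.map fun d i => algebraMap ℂ R (d i)).map fun d i => κ * d i)
        (z ^ N * κ ^ N)).charpoly.coeff a := by
    change (aeval κ : ℂ[X] →ₐ[ℂ] R).toRingHom _ = _
    rw [← coeff_map, cyclicCurveInfty, ← Matrix.charpoly_map, cyclicProd_map, List.map_map,
      List.map_map]
    congr 3
    · refine List.map_congr_left fun d _ => funext fun i => ?_
      simp [mul_comm κ]
    · simp [← mul_pow, mul_comm z, h]
  rw [e1, e2, h1, List.length_map]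

theorem cyclicCurveInfty_map_eval_zero (hN : 0 < N) (ds : List (Fin N → ℂ))
    (hm : Nat.Coprime ds.length N) :
    (cyclicCurveInfty ds).map (evalRingHom 0) = X ^ N - 1 := by
  rw [cyclicCurveInfty, ← Matrix.charpoly_map, cyclicProd_map, cyclicProd_zero]
  · simp only [List.length_map, map_one]
    exact charpoly_cyclicBidiagonal_zero_one_pow hN hm
  · intro d hd
    simp only [List.mem_map, exists_exists_and_eq_and] at hd
    obtain ⟨e, -, rfl⟩ := hd
    funext i
    simp

theorem coeff_algebraMap_mul (c : ℂ) (f : LaurentSeries ℂ) (n : ℤ) :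
    (algebraMap ℂ (LaurentSeries ℂ) c * f).coeff n = c * f.coeff n := by
  rw [LaurentSeries.algebraMap_apply, HahnSeries.C_mul_eq_smul, HahnSeries.coeff_smul, smul_eq_mul]

theorem coeff_aeval_single {c : ℤ} (hc : c ≠ 0) (p : ℂ[X]) (b : ℕ) :
    (aeval (HahnSeries.single c 1 : LaurentSeries ℂ) p).coeff (c * b) = p.coeff b := by
  rw [aeval_eq_sum_range, HahnSeries.coeff_sum, Finset.sum_eq_single b]
  · rw [Algebra.smul_def, coeff_algebraMap_mul, HahnSeries.single_pow, one_pow, nsmul_eq_mul, mul_comm (b : ℤ),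
      HahnSeries.coeff_single_same, mul_one]
  · intro i _ hi
    have : c * (b : ℤ) ≠ i * c := by
      rw [mul_comm]
      intro h
      exact hi (by exact_mod_cast (mul_right_cancel₀ hc h).symm)
    rw [Algebra.smul_def, coeff_algebraMap_mul, HahnSeries.single_pow, one_pow, nsmul_eq_mul,
      HahnSeries.coeff_single_of_ne this, mul_zero]
  · intro h
    have : p.coeff b = 0 := coeff_eq_zero_of_natDegree_lt (by simpa using h)
    rw [Algebra.smul_def, coeff_algebraMap_mul, this, zero_mul]

theorem coeff_aeval_single_one_of_neg (p : ℂ[X]) {n : ℤ} (hn : n < 0) :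
    (aeval (HahnSeries.single 1 1 : LaurentSeries ℂ) p).coeff n = 0 := by
  rw [aeval_eq_sum_range, HahnSeries.coeff_sum]
  refine Finset.sum_eq_zero fun i _ => ?_
  have : n ≠ i * 1 := by omega
  rw [Algebra.smul_def, coeff_algebraMap_mul, HahnSeries.single_pow, one_pow, nsmul_eq_mul,
    HahnSeries.coeff_single_of_ne this, mul_zero]

/-- Comparison of Laurent coefficients, `κ` being the series variable and `z` its inverse. No
negative powers of `κ` occur in the chart at infinity, which bounds the weight of the monomials;
those of maximal weight are seen at `κ = 0`. -/
theorem cyclicCurve_coeff_coeff (hN : 0 < N) (ds : List (Fin N → ℂ)) (a b : ℕ) (ha : a ≤ N) :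
    ((cyclicCurve ds).coeff a).coeff b =
      if N * b ≤ ds.length * (N - a) then
        ((cyclicCurveInfty ds).coeff a).coeff (ds.length * (N - a) - N * b) else 0 := by
  have h := aeval_coeff_cyclicCurve (R := LaurentSeries ℂ) (z := HahnSeries.single (-1) 1)
    (κ := HahnSeries.single 1 1) (by simp) ds a ha
  have hNz : (-(N : ℤ)) ≠ 0 := by omega
  have h1 := coeff_aeval_single hNz ((cyclicCurve ds).coeff a) b
  rw [HahnSeries.single_pow, HahnSeries.single_pow, one_pow, one_pow,
    show N • (-1 : ℤ) = -(N : ℤ) by simp] at h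
  rw [h, HahnSeries.coeff_single_mul, one_mul] at h1
  rw [← h1]
  have e : (-(N : ℤ)) * b - (ds.length * (N - a)) • (-1 : ℤ) =
      ((ds.length * (N - a) : ℕ) : ℤ) - ((N * b : ℕ) : ℤ) := by
    rw [nsmul_eq_mul, Nat.cast_mul N b]
    ring
  rw [e]
  split_ifs with hle
  · rw [← Nat.cast_sub hle]
    have := coeff_aeval_single (c := 1) one_ne_zero ((cyclicCurveInfty ds).coeff a)
      (ds.length * (N - a) - N * b)
    rwa [one_mul] at this
  · exact coeff_aeval_single_one_of_neg _ (by omega)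

theorem cyclicCurve_coeff_coeff_of_lt (hN : 0 < N) (ds : List (Fin N → ℂ)) (a b : ℕ) (ha : a ≤ N)
    (h : ds.length * (N - a) < N * b) : ((cyclicCurve ds).coeff a).coeff b = 0 := by
  rw [cyclicCurve_coeff_coeff hN ds a b ha, if_neg (by omega)]

theorem cyclicCurve_coeff_coeff_of_eq (hN : 0 < N) (ds : List (Fin N → ℂ))
    (hm : Nat.Coprime ds.length N) (a b : ℕ) (ha : a ≤ N)
    (h : N * b = ds.length * (N - a)) :
    ((cyclicCurve ds).coeff a).coeff b = (X ^ N - 1 : ℂ[X]).coeff a := by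
  rw [cyclicCurve_coeff_coeff hN ds a b ha, if_pos h.le, ← cyclicCurveInfty_map_eval_zero hN ds hm,
    coeff_map, h, Nat.sub_self, coe_evalRingHom, coeff_zero_eq_eval_zero]

end Weights

/-! ### Valuations at which `y` has a pole. -/

section ValuationsAtInfinity

variable {K : Type*} [Field K] [Algebra ℂ K] {v : Valuation K ℤᵐ⁰}

theorem aevalAeval_eq_sum (x y : K) (p : ℂ[X][X]) {n : ℕ} (hn : p.natDegree < n) :
    aevalAeval y x p = ∑ a ∈ Finset.range n, aeval y (p.coeff a) * x ^ a := by
  conv_lhs => rw [p.as_sum_range' n hn]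
  simp [map_sum, ← C_mul_X_pow_eq_monomial]

theorem val_const_le_one (hv : ∀ c : ℂ, c ≠ 0 → v (algebraMap ℂ K c) = 1) (c : ℂ) :
    v (algebraMap ℂ K c) ≤ 1 := by
  rcases eq_or_ne c 0 with rfl | hc
  · simp
  · exact (hv c hc).le

theorem val_aeval_of_one_lt (hv : ∀ c : ℂ, c ≠ 0 → v (algebraMap ℂ K c) = 1) {y : K}
    (hy : 1 < v y) {p : ℂ[X]} (hp : p ≠ 0) : v (aeval y p) = v y ^ p.natDegree := by
  have hlead : v (p.coeff p.natDegree • y ^ p.natDegree) = v y ^ p.natDegree := by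
    rw [Algebra.smul_def, map_mul, map_pow, hv _ (by simpa using hp), one_mul]
  rw [aeval_eq_sum_range, Valuation.map_sum_eq_of_lt v (j := p.natDegree), hlead]
  · simp
  · intro i hi
    simp only [Finset.mem_sdiff, Finset.mem_range, Finset.mem_singleton] at hi
    rw [hlead, Algebra.smul_def, map_mul, map_pow]
    calc _ ≤ 1 * v y ^ i := mul_le_mul_left (val_const_le_one hv _) _
      _ = v y ^ i := one_mul _
      _ < _ := pow_lt_pow_right₀ hy (by omega)

/-- The order of the pole at infinity of a polynomial in `x` and `y`, if the orders of the poles of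
`x` and `y` are `m` and `N`. -/
def weightedDegree (m N : ℕ) (p : ℂ[X][X]) : ℕ :=
  p.support.sup fun a => m * a + N * (p.coeff a).natDegree

/-- Modulo `N` the weight `m * a + N * b` is `m * a`, which determines `a < N`. Hence distinct
powers of `x` contribute distinct values, and the largest one prevails. -/
theorem val_aevalAeval_eq (hv : ∀ c : ℂ, c ≠ 0 → v (algebraMap ℂ K c) = 1) {m N : ℕ}
    (hN : 0 < N) (hm : Nat.Coprime m N) {x y : K} {e : ℤ} (he : 0 < e)
    (hx : v x = WithZero.exp (m * e)) (hy : v y = WithZero.exp (N * e)) {p : ℂ[X][X]}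
    (hp : p ≠ 0) (hpN : p.natDegree < N) :
    v (aevalAeval y x p) = WithZero.exp (weightedDegree m N p * e) := by
  have hy1 : 1 < v y := by
    rw [hy, ← WithZero.exp_zero, WithZero.exp_lt_exp]
    positivity
  have hterm : ∀ a ∈ p.support, v (aeval y (p.coeff a) * x ^ a) =
      WithZero.exp ((m * a + N * (p.coeff a).natDegree : ℕ) * e) := by
    intro a ha
    rw [map_mul, map_pow, val_aeval_of_one_lt hv hy1 (mem_support_iff.1 ha), hx, hy,
      ← WithZero.exp_nsmul, ← WithZero.exp_nsmul, ← WithZero.exp_add]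
    congr 1
    simp only [nsmul_eq_mul]
    push_cast
    ring
  obtain ⟨a₀, ha₀, hmax⟩ := Finset.exists_mem_eq_sup p.support (support_nonempty.2 hp)
    (fun a => m * a + N * (p.coeff a).natDegree)
  have hsum : aevalAeval y x p = ∑ a ∈ p.support, aeval y (p.coeff a) * x ^ a := by
    rw [aevalAeval_eq_sum x y p (Nat.lt_succ_self _)]
    symm
    refine Finset.sum_subset (fun a ha => Finset.mem_range_succ_iff.2 (le_natDegree_of_mem_supp a ha))
      fun a _ ha => ?_
    rw [notMem_support_iff.1 ha]
    simp
  rw [hsum, weightedDegree, hmax, ← hterm a₀ ha₀]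
  refine Valuation.map_sum_eq_of_lt v ha₀ ?_
  · intro a ha
    simp only [Finset.mem_sdiff, Finset.mem_singleton] at ha
    rw [hterm a ha.1, hterm a₀ ha₀, WithZero.exp_lt_exp]
    refine mul_lt_mul_of_pos_right ?_ he
    rw [Nat.cast_lt]
    refine lt_of_le_of_ne ?_ ?_
    · rw [← hmax]
      exact Finset.le_sup (f := fun a => m * a + N * (p.coeff a).natDegree) ha.1
    · intro heq
      have h1 : m * a ≡ m * a₀ [MOD N] := by
        have := congrArg (· % N) heq
        simpa [Nat.ModEq] using this
      have h2 : a ≡ a₀ [MOD N] := Nat.ModEq.cancel_left_of_coprime (by rwa [Nat.gcd_comm]) h1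
      have h3 := le_natDegree_of_mem_supp a ha.1
      have h4 := le_natDegree_of_mem_supp a₀ ha₀
      exact ha.2 (Nat.ModEq.eq_of_lt_of_lt h2 (by omega) (by omega))

variable {N : ℕ}

/-- All monomials of `F` other than `x ^ N` and `-y ^ m` have smaller weight. The maximum appears
because the values of `x ^ N` and `y ^ m` are not yet known to agree. -/
theorem val_pow_sub_pow_lt (hv : ∀ c : ℂ, c ≠ 0 → v (algebraMap ℂ K c) = 1) (hN : 0 < N)
    (ds : List (Fin N → ℂ)) (hm0 : 0 < ds.length) (hm : Nat.Coprime ds.length N) {x y : K}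
    (hF : aevalAeval y x (cyclicCurve ds) = 0) (hy : 1 < v y) :
    v (x ^ N - y ^ ds.length) < max (v x ^ N) (v y ^ ds.length) := by
  set m := ds.length with hmdef
  set μ := max (v x ^ N) (v y ^ m) with hμ
  have hμ1 : 1 < μ := lt_max_of_lt_right (one_lt_pow₀ hy hm0.ne')
  have hterm : ∀ a b : ℕ, N * b + m * a < N * m → v y ^ b * v x ^ a < μ := by
    intro a b hab
    -- The power `N * m` allows `v y` and `v x` to be bounded through `v y ^ m` and `v x ^ N`.
    refine lt_of_pow_lt_pow_left₀ (N * m) zero_le ?_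
    calc (v y ^ b * v x ^ a) ^ (N * m) = (v y ^ m) ^ (N * b) * (v x ^ N) ^ (m * a) := by
          rw [mul_pow, ← pow_mul, ← pow_mul, ← pow_mul, ← pow_mul]
          congr 2 <;> ring
      _ ≤ μ ^ (N * b) * μ ^ (m * a) :=
          mul_le_mul' (pow_le_pow_left' (le_max_right _ _) _)
            (pow_le_pow_left' (le_max_left _ _) _)
      _ = μ ^ (N * b + m * a) := (pow_add _ _ _).symm
      _ < μ ^ (N * m) := pow_lt_pow_right₀ hμ1 hab
  -- The coefficients of `F - x ^ N + y ^ m`.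
  set h : ℕ → ℂ[X] := fun a => (cyclicCurve ds).coeff a + if a = 0 then X ^ m else 0 with hh
  have hsupp : ∀ a < N, ∀ b, (h a).coeff b ≠ 0 → N * b + m * a < N * m := by
    intro a ha b hb
    by_contra hle
    have hma : m * (N - a) = m * N - m * a := Nat.mul_sub _ _ _
    have hma' : m * a ≤ m * N := Nat.mul_le_mul_left _ ha.le
    have hcomm : N * m = m * N := mul_comm _ _
    apply hb
    rcases lt_or_eq_of_le (show m * (N - a) ≤ N * b by omega) with hlt | heq
    · rw [hh]
      simp only [coeff_add]
      rw [cyclicCurve_coeff_coeff_of_lt hN ds a b ha.le hlt, zero_add]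
      split_ifs with h0
      · subst h0
        rw [coeff_X_pow, if_neg]
        rintro rfl
        simp [hcomm] at hlt
      · simp
    · rw [hh]
      simp only [coeff_add]
      rw [cyclicCurve_coeff_coeff_of_eq hN ds hm a b ha.le heq.symm, coeff_sub, coeff_X_pow,
        if_neg ha.ne, coeff_one]
      split_ifs with h0
      · subst h0
        have hbm : b = m := by
          apply Nat.eq_of_mul_eq_mul_left hN
          rw [← heq, hcomm, Nat.sub_zero]
        simp [hbm]
      · simp
  have hsum : x ^ N - y ^ m = - ∑ a ∈ Finset.range N, aeval y (h a) * x ^ a := by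
    rw [aevalAeval_eq_sum x y _ (n := N + 1) (by rw [cyclicCurve_natDegree]; omega),
      Finset.sum_range_succ] at hF
    have hlc : (cyclicCurve ds).coeff N = 1 := by
      have := (cyclicCurve_monic ds).coeff_natDegree
      rwa [cyclicCurve_natDegree] at this
    rw [hlc, map_one, one_mul] at hF
    have : ∑ a ∈ Finset.range N, aeval y (h a) * x ^ a =
        ∑ a ∈ Finset.range N, aeval y ((cyclicCurve ds).coeff a) * x ^ a + y ^ m := by
      simp only [hh, map_add, add_mul, Finset.sum_add_distrib]
      congr 1
      rw [Finset.sum_eq_single 0]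
      · simp
      · intro a _ ha
        simp [ha]
      · simp [hN.ne']
    rw [this]
    linear_combination hF
  rw [hsum, Valuation.map_neg]
  refine Valuation.map_sum_lt v (zero_lt_one.trans hμ1).ne' fun a ha => ?_
  rw [aeval_eq_sum_range, Finset.sum_mul]
  refine Valuation.map_sum_lt v (zero_lt_one.trans hμ1).ne' fun b _ => ?_
  by_cases hb : (h a).coeff b = 0
  · rw [hb, zero_smul, zero_mul, map_zero]
    exact zero_lt_one.trans hμ1
  · rw [Algebra.smul_def, map_mul, map_mul, map_pow, map_pow, hv _ hb, one_mul]
    exact hterm a b (hsupp a (Finset.mem_range.1 ha) b hb)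

theorem val_pow_eq_val_pow (hv : ∀ c : ℂ, c ≠ 0 → v (algebraMap ℂ K c) = 1) (hN : 0 < N)
    (ds : List (Fin N → ℂ)) (hm0 : 0 < ds.length) (hm : Nat.Coprime ds.length N) {x y : K}
    (hF : aevalAeval y x (cyclicCurve ds) = 0) (hy : 1 < v y) :
    v x ^ N = v y ^ ds.length := by
  have h := val_pow_sub_pow_lt hv hN ds hm0 hm hF hy
  rw [← map_pow, ← map_pow] at h ⊢
  by_contra hne
  have h2 := Valuation.map_add_of_distinct_val v (x := x ^ N) (y := -y ^ ds.length)
    (by rwa [Valuation.map_neg])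
  rw [Valuation.map_neg, ← sub_eq_add_neg] at h2
  exact h.ne h2

theorem exists_exp_of_one_lt (hv : ∀ c : ℂ, c ≠ 0 → v (algebraMap ℂ K c) = 1) (hN : 0 < N)
    (ds : List (Fin N → ℂ)) (hm0 : 0 < ds.length) (hm : Nat.Coprime ds.length N) {x y : K}
    (hF : aevalAeval y x (cyclicCurve ds) = 0) (hy : 1 < v y) :
    ∃ e : ℤ, 0 < e ∧ v x = WithZero.exp (ds.length * e) ∧ v y = WithZero.exp (N * e) := by
  have h := val_pow_eq_val_pow hv hN ds hm0 hm hF hy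
  have hy0 : v y ≠ 0 := (zero_lt_one.trans hy).ne'
  have hx0 : v x ≠ 0 := by
    intro h0
    rw [h0, zero_pow hN.ne'] at h
    exact pow_ne_zero _ hy0 h.symm
  rw [← WithZero.exp_log hx0, ← WithZero.exp_log hy0, ← WithZero.exp_nsmul, ← WithZero.exp_nsmul,
    WithZero.exp_inj, nsmul_eq_mul, nsmul_eq_mul] at h
  have hd : (N : ℤ) ∣ WithZero.log (v y) := by
    refine (Nat.isCoprime_iff_coprime.2 hm.symm).dvd_of_dvd_mul_left ⟨_, h.symm⟩
  obtain ⟨e, he⟩ := hd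
  have hNz : (N : ℤ) ≠ 0 := by omega
  refine ⟨e, ?_, ?_, ?_⟩
  · rw [← WithZero.exp_log hy0, ← WithZero.exp_zero, WithZero.exp_lt_exp, he] at hy
    exact pos_of_mul_pos_right hy (by positivity)
  · rw [← WithZero.exp_log hx0]
    congr 1
    apply mul_left_cancel₀ hNz
    rw [h, he]; ring
  · rw [← he, WithZero.exp_log hy0]

end ValuationsAtInfinity

/-! ### Hensel's lemma and the order of Laurent series. -/

section PowerSeriesRoots

theorem exists_powerSeries_root {f : (PowerSeries ℂ)[X]} (hf : f.Monic) {c : ℂ}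
    (h0 : (f.map (PowerSeries.constantCoeff (R := ℂ))).eval c = 0)
    (h1 : (derivative (f.map (PowerSeries.constantCoeff (R := ℂ)))).eval c ≠ 0) :
    ∃ ξ : PowerSeries ℂ, f.eval ξ = 0 ∧ PowerSeries.constantCoeff ξ = c := by
  have hc : c = PowerSeries.constantCoeff (PowerSeries.C c) := by simp
  rw [hc, eval_map_apply] at h0
  rw [hc, derivative_map, eval_map_apply] at h1
  obtain ⟨ξ, h2, h3⟩ := HenselianRing.is_henselian (I := Ideal.span {(PowerSeries.X : PowerSeries ℂ)})
    f hf (PowerSeries.C c)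
    (by rw [Ideal.mem_span_singleton, PowerSeries.X_dvd_iff]; exact h0)
    (by
      refine IsUnit.map _ ?_
      rw [PowerSeries.isUnit_iff_constantCoeff]
      exact isUnit_iff_ne_zero.2 h1)
  refine ⟨ξ, h2, ?_⟩
  rw [Ideal.mem_span_singleton, PowerSeries.X_dvd_iff, map_sub, ← hc, sub_eq_zero] at h3
  exact h3

theorem laurent_val_coe_lt_one_iff (f : PowerSeries ℂ) :
    Valued.v (HahnSeries.ofPowerSeries ℤ ℂ f) < 1 ↔ PowerSeries.constantCoeff f = 0 := by
  have h : ∀ γ : ℤᵐ⁰, γ < 1 ↔ γ ≤ WithZero.exp (-1 : ℤ) := by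
    intro γ
    rcases eq_or_ne γ 0 with rfl | hγ
    · simp
    · rw [← WithZero.exp_log hγ, ← WithZero.exp_zero, WithZero.exp_lt_exp, WithZero.exp_le_exp]
      omega
  rw [h, LaurentSeries.valuation_le_iff_coeff_lt_eq_zero]
  constructor
  · intro h0
    have := h0 0 (by norm_num)
    rw [PowerSeries.coeff_coe] at this
    simpa using this
  · intro h0 n hn
    rw [PowerSeries.coeff_coe]
    split_ifs with hneg
    · rfl
    · obtain rfl : n = 0 := by omega
      simpa using h0

theorem laurent_val_coe_le_one (f : PowerSeries ℂ) :
    Valued.v (HahnSeries.ofPowerSeries ℤ ℂ f) ≤ 1 :=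
  (LaurentSeries.val_le_one_iff_eq_coe ℂ _).2 ⟨f, rfl⟩

theorem laurent_val_coe_eq_one {f : PowerSeries ℂ} (hf : PowerSeries.constantCoeff f ≠ 0) :
    Valued.v (HahnSeries.ofPowerSeries ℤ ℂ f) = 1 :=
  (laurent_val_coe_le_one f).eq_of_not_lt fun h => hf ((laurent_val_coe_lt_one_iff f).1 h)

theorem laurent_algebraMap (c : ℂ) :
    algebraMap ℂ (LaurentSeries ℂ) c = HahnSeries.ofPowerSeries ℤ ℂ (PowerSeries.C c) := by
  rw [LaurentSeries.algebraMap_apply, PowerSeries.coe_C]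

theorem laurent_val_const (c : ℂ) (hc : c ≠ 0) :
    Valued.v (algebraMap ℂ (LaurentSeries ℂ) c) = 1 := by
  rw [laurent_algebraMap, laurent_val_coe_eq_one]
  simpa using hc

theorem laurent_aevalAeval_coe (ξ η : PowerSeries ℂ) (p : ℂ[X][X]) :
    aevalAeval (HahnSeries.ofPowerSeries ℤ ℂ η) (HahnSeries.ofPowerSeries ℤ ℂ ξ) p =
      HahnSeries.ofPowerSeries ℤ ℂ (aevalAeval η ξ p) := by
  have : (aevalAeval (HahnSeries.ofPowerSeries ℤ ℂ η) (HahnSeries.ofPowerSeries ℤ ℂ ξ) :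
      ℂ[X][X] →ₐ[ℂ] LaurentSeries ℂ).toRingHom =
      (HahnSeries.ofPowerSeries ℤ ℂ).comp (aevalAeval η ξ).toRingHom := by
    refine Polynomial.ringHom_ext' (Polynomial.ringHom_ext (fun c => ?_) ?_) ?_
    · simp [laurent_algebraMap, PowerSeries.algebraMap_eq]
    · simp
    · simp
  exact congrArg (fun f => f p) this

end PowerSeriesRoots

/-! ### Points of the curve from embeddings of its function field. -/

section RationalFunctions

variable {F : ℂ[X][X]}

theorem aevalAeval_yFun_xFun (p : ℂ[X][X]) :
    aevalAeval (yFun F) (xFun F) p = algebraMap (AdjoinRoot F) (RatFun F) (AdjoinRoot.mk F p) := by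
  have : aevalAeval (yFun F) (xFun F) = ((IsScalarTower.toAlgHom ℂ (AdjoinRoot F) (RatFun F)).comp
      (AdjoinRoot.mkₐ F |>.restrictScalars ℂ)) := by
    ext <;> simp [xFun, yFun]
  rw [this]
  rfl

theorem aevalAeval_yFun_xFun_self : aevalAeval (yFun F) (xFun F) F = 0 := by
  rw [aevalAeval_yFun_xFun, AdjoinRoot.mk_self, map_zero]

/-- A pair of elements of a field on the curve `F(x, y) = 0`, at which no nonzero regular function
vanishes, defines an embedding of the field of rational functions. -/
theorem exists_ratFun_hom {L : Type*} [Field L] [Algebra ℂ L] {x y : L}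
    (hF : aevalAeval y x F = 0)
    (hinj : ∀ p : ℂ[X][X], aevalAeval y x p = 0 → F ∣ p) :
    IsDomain (AdjoinRoot F) ∧ ∃ ψ : RatFun F →+* L,
      ∀ p : ℂ[X][X], ψ (aevalAeval (yFun F) (xFun F) p) = aevalAeval y x p := by
  set φ : AdjoinRoot F →+* L := Ideal.Quotient.lift (Ideal.span {F}) (aevalAeval y x).toRingHom
    (by
      intro a ha
      obtain ⟨b, rfl⟩ := Ideal.mem_span_singleton.1 ha
      change aevalAeval y x (F * b) = 0
      rw [map_mul, hF, zero_mul]) with hφ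
  have hφm : ∀ p, φ (AdjoinRoot.mk F p) = aevalAeval y x p := fun p => rfl
  have hφi : Function.Injective φ := by
    rw [injective_iff_map_eq_zero]
    intro f hf
    obtain ⟨p, rfl⟩ := AdjoinRoot.mk_surjective f
    rw [hφm] at hf
    exact AdjoinRoot.mk_eq_zero.2 (hinj p hf)
  have hd : IsDomain (AdjoinRoot F) := hφi.isDomain φ
  refine ⟨hd, IsFractionRing.lift hφi, fun p => ?_⟩
  rw [aevalAeval_yFun_xFun, IsFractionRing.lift_algebraMap, hφm]

theorem exists_curvePoint [IsDomain (AdjoinRoot F)] (ψ : RatFun F →+* LaurentSeries ℂ)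
    (hψ : ∀ c, ψ (algebraMap ℂ (RatFun F) c) = algebraMap ℂ (LaurentSeries ℂ) c)
    (f : RatFun F) (hf : Valued.v (ψ f) = WithZero.exp (-1 : ℤ)) :
    ∃ P : CurvePoint F, ∀ g, P.val g = Valued.v (ψ g) := by
  refine ⟨⟨(Valued.v (R := LaurentSeries ℂ)).comap ψ, ?_, ?_⟩, fun g => rfl⟩
  · intro γ
    rcases eq_or_ne γ 0 with rfl | hγ
    · exact ⟨0, by simp⟩
    · refine ⟨f ^ (-WithZero.log γ), ?_⟩
      rw [Valuation.comap_apply, map_zpow₀, map_zpow₀, hf, ← WithZero.exp_zsmul]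
      simp [WithZero.exp_log hγ]
  · intro c hc
    rw [Valuation.comap_apply, hψ, laurent_val_const c hc]

end RationalFunctions

/-! ### Existence and uniqueness of the point at infinity. -/

section PointAtInfinity

variable {N : ℕ}

/-- Hensel lifts the simple root `1` of `X ^ N - 1` to a root `ξ` of the chart at infinity; the
point is `y = z ^ N`, `x = z ^ m ξ`. -/
theorem exists_laurentSeries_point_at_infinity (hN : 0 < N)
    (ds : List (Fin N → ℂ)) (hm : Nat.Coprime ds.length N) :
    ∃ x y : LaurentSeries ℂ, aevalAeval y x (cyclicCurve ds) = 0 ∧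
      Valued.v x = WithZero.exp (ds.length : ℤ) ∧ Valued.v y = WithZero.exp (N : ℤ) := by
  set G := (cyclicCurveInfty ds).map (aeval (PowerSeries.X : PowerSeries ℂ)).toRingHom with hG
  have hGc : G.map (PowerSeries.constantCoeff (R := ℂ)) = X ^ N - 1 := by
    rw [← cyclicCurveInfty_map_eval_zero hN ds hm, hG, Polynomial.map_map]
    congr 1
    refine Polynomial.ringHom_ext (fun c => ?_) ?_
    · simp [PowerSeries.algebraMap_eq]
    · simp
  obtain ⟨ξ, hξ, hξ1⟩ := exists_powerSeries_root (f := G) (c := 1)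
    ((Matrix.charpoly_monic _).map _) (by rw [hGc]; simp) (by rw [hGc]; simp [derivative_X_pow, hN.ne'])
  set ι := HahnSeries.ofPowerSeries ℤ ℂ with hι
  set z : LaurentSeries ℂ := HahnSeries.single (-1) 1 with hz
  have hιX : ι PowerSeries.X * z = 1 := by
    rw [hι, PowerSeries.coe_X, hz]
    simp
  have hpow : ∀ n : ℕ, Valued.v (z ^ n) = WithZero.exp (n : ℤ) := by
    intro n
    rw [hz, HahnSeries.single_pow, one_pow, LaurentSeries.valuation_single_zpow]
    simp
  refine ⟨z ^ ds.length * ι ξ, z ^ N, ?_, ?_, hpow N⟩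
  · have h0 : aevalAeval (ι PowerSeries.X) (ι ξ) (cyclicCurveInfty ds) = 0 := by
      have h1 : aevalAeval PowerSeries.X ξ (cyclicCurveInfty ds) = G.eval ξ := by
        rw [hG, eval_map]
        refine congrArg (fun f : ℂ[X][X] →+* PowerSeries ℂ => f (cyclicCurveInfty ds))
          (?_ : (aevalAeval PowerSeries.X ξ).toRingHom = eval₂RingHom
            (aeval (PowerSeries.X : PowerSeries ℂ)).toRingHom ξ)
        refine Polynomial.ringHom_ext' (Polynomial.ringHom_ext (fun c => ?_) ?_) ?_ <;> simp
      rw [hι, laurent_aevalAeval_coe, h1, hξ, map_zero]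
    have hdeg : (cyclicCurveInfty ds).natDegree < N + 1 := by
      rw [cyclicCurveInfty, Matrix.charpoly_natDegree_eq_dim, Fintype.card_fin]
      omega
    rw [aevalAeval_eq_sum _ _ _ hdeg] at h0
    rw [aevalAeval_eq_sum _ _ _ (n := N + 1) (by rw [cyclicCurve_natDegree]; omega)]
    rw [← mul_zero (z ^ (ds.length * N)), ← h0, Finset.mul_sum]
    refine Finset.sum_congr rfl fun a ha => ?_
    have ha' : a ≤ N := Finset.mem_range_succ_iff.1 ha
    rw [aeval_coeff_cyclicCurve hιX ds a ha', mul_pow, ← pow_mul]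
    have : z ^ (ds.length * N) = z ^ (ds.length * (N - a)) * z ^ (ds.length * a) := by
      rw [← pow_add, ← mul_add, Nat.sub_add_cancel ha']
    rw [this]
    ring
  · rw [map_mul, hpow, laurent_val_coe_eq_one (by rw [hξ1]; exact one_ne_zero), mul_one]

/-- The remainder modulo `F` has degree less than `N` in `x`; if nonzero, it would have nonzero
value. -/
theorem dvd_of_val_exp (hN : 0 < N) (ds : List (Fin N → ℂ)) (hm : Nat.Coprime ds.length N)
    {L : Type*} [Field L] [Algebra ℂ L] {v : Valuation L ℤᵐ⁰}
    (hv : ∀ c : ℂ, c ≠ 0 → v (algebraMap ℂ L c) = 1) {x y : L}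
    (hF : aevalAeval y x (cyclicCurve ds) = 0) {e : ℤ} (he : 0 < e)
    (hx : v x = WithZero.exp (ds.length * e)) (hy : v y = WithZero.exp (N * e)) (p : ℂ[X][X])
    (hp : aevalAeval y x p = 0) : cyclicCurve ds ∣ p := by
  have hmod : aevalAeval y x (p %ₘ cyclicCurve ds) = 0 := by
    rw [modByMonic_eq_sub_mul_div p, map_sub, map_mul, hF, hp]
    simp
  rw [← modByMonic_eq_zero_iff_dvd (cyclicCurve_monic ds)]
  by_contra hne
  have := val_aevalAeval_eq hv hN hm he hx hy hne
    (lt_of_lt_of_eq (natDegree_modByMonic_lt p (cyclicCurve_monic ds) (fun h => by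
      have := cyclicCurve_natDegree ds
      rw [h, natDegree_one] at this
      omega)) (cyclicCurve_natDegree ds))
  rw [hmod, map_zero] at this
  exact WithZero.exp_ne_zero this.symm

theorem val_mk_eq (hN : 0 < N) (ds : List (Fin N → ℂ)) (hm : Nat.Coprime ds.length N)
    {L : Type*} [Field L] [Algebra ℂ L] {v : Valuation L ℤᵐ⁰}
    (hv : ∀ c : ℂ, c ≠ 0 → v (algebraMap ℂ L c) = 1) {x y : L}
    (hF : aevalAeval y x (cyclicCurve ds) = 0) {e : ℤ} (he : 0 < e)
    (hx : v x = WithZero.exp (ds.length * e)) (hy : v y = WithZero.exp (N * e)) (p : ℂ[X][X])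
    (hp : ¬ cyclicCurve ds ∣ p) :
    v (aevalAeval y x p) =
      WithZero.exp (weightedDegree ds.length N (p %ₘ cyclicCurve ds) * e) := by
  have hmod : aevalAeval y x (p %ₘ cyclicCurve ds) = aevalAeval y x p := by
    rw [modByMonic_eq_sub_mul_div p, map_sub, map_mul, hF]
    simp
  rw [← hmod]
  refine val_aevalAeval_eq hv hN hm he hx hy
    (fun h => hp ((modByMonic_eq_zero_iff_dvd (cyclicCurve_monic ds)).1 h))
    (lt_of_lt_of_eq (natDegree_modByMonic_lt p (cyclicCurve_monic ds) (fun h => by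
      have := cyclicCurve_natDegree ds
      rw [h, natDegree_one] at this
      omega)) (cyclicCurve_natDegree ds))

theorem isDomain_adjoinRoot_cyclicCurve (hN : 0 < N) (ds : List (Fin N → ℂ))
    (hm : Nat.Coprime ds.length N) : IsDomain (AdjoinRoot (cyclicCurve ds)) := by
  obtain ⟨x, y, hF, hx, hy⟩ := exists_laurentSeries_point_at_infinity hN ds hm
  exact (exists_ratFun_hom hF (dvd_of_val_exp hN ds hm laurent_val_const hF one_pos
    (by simpa using hx) (by simpa using hy))).1

theorem CurvePoint.ext_of_mk {F : ℂ[X][X]} [IsDomain (AdjoinRoot F)] {q r : CurvePoint F}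
    (h : ∀ p : ℂ[X][X], q.val (aevalAeval (yFun F) (xFun F) p) = r.val (aevalAeval (yFun F) (xFun F) p)) :
    q = r := by
  ext f
  obtain ⟨a, b, hb, rfl⟩ := IsFractionRing.div_surjective (A := AdjoinRoot F) f
  obtain ⟨p, rfl⟩ := AdjoinRoot.mk_surjective a
  obtain ⟨p', rfl⟩ := AdjoinRoot.mk_surjective b
  rw [map_div₀, map_div₀, ← aevalAeval_yFun_xFun, ← aevalAeval_yFun_xFun, h, h]

/-- If the orders of all regular functions at `q` are multiples of `e`, then `e` is a unit. -/
theorem CurvePoint.isUnit_of_val_mk {F : ℂ[X][X]} [IsDomain (AdjoinRoot F)] (q : CurvePoint F)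
    (e : ℤ) (h : ∀ p, ¬ F ∣ p → ∃ n : ℤ,
      q.val (aevalAeval (yFun F) (xFun F) p) = WithZero.exp (n * e)) : IsUnit e := by
  obtain ⟨f, hf⟩ := q.surjective (WithZero.exp 1)
  obtain ⟨a, b, hb, rfl⟩ := IsFractionRing.div_surjective (A := AdjoinRoot F) f
  obtain ⟨p, rfl⟩ := AdjoinRoot.mk_surjective a
  obtain ⟨p', rfl⟩ := AdjoinRoot.mk_surjective b
  have hp' : ¬ F ∣ p' := fun hd => nonZeroDivisors.ne_zero hb (AdjoinRoot.mk_eq_zero.2 hd)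
  have hp : ¬ F ∣ p := by
    intro hd
    rw [AdjoinRoot.mk_eq_zero.2 hd, map_zero, zero_div, map_zero] at hf
    exact WithZero.exp_ne_zero hf.symm
  obtain ⟨n, hn⟩ := h p hp
  obtain ⟨n', hn'⟩ := h p' hp'
  rw [map_div₀, ← aevalAeval_yFun_xFun, ← aevalAeval_yFun_xFun, hn, hn', ← WithZero.exp_sub,
    WithZero.exp_inj, ← sub_mul] at hf
  exact IsUnit.of_mul_eq_one _ (by rw [mul_comm]; exact hf)

/-- All orders are multiples of `e`, and the valuation is normalised, so `e = 1`. -/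
theorem CurvePoint.val_of_pole (hN : 0 < N) (ds : List (Fin N → ℂ)) (hm0 : 0 < ds.length)
    (hm : Nat.Coprime ds.length N) (q : CurvePoint (cyclicCurve ds)) (hq : q.HasPole (yFun _)) :
    q.val (xFun _) = WithZero.exp (ds.length : ℤ) ∧ q.val (yFun _) = WithZero.exp (N : ℤ) ∧
    ∀ p, ¬ cyclicCurve ds ∣ p → q.val (aevalAeval (yFun _) (xFun _) p) =
      WithZero.exp (weightedDegree ds.length N (p %ₘ cyclicCurve ds) : ℤ) := by
  have := isDomain_adjoinRoot_cyclicCurve hN ds hm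
  obtain ⟨e, he, hx, hy⟩ := exists_exp_of_one_lt (v := q.val) q.val_const hN ds hm0 hm
    aevalAeval_yFun_xFun_self hq
  have hall := val_mk_eq hN ds hm (v := q.val) q.val_const aevalAeval_yFun_xFun_self he hx hy
  have hu := q.isUnit_of_val_mk e fun p hp => ⟨_, hall p hp⟩
  obtain rfl : e = 1 := by
    rcases Int.isUnit_iff.1 hu with h | h <;> omega
  simp only [mul_one] at hx hy hall
  exact ⟨hx, hy, hall⟩

theorem CurvePoint.eq_of_pole (hN : 0 < N) (ds : List (Fin N → ℂ)) (hm0 : 0 < ds.length)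
    (hm : Nat.Coprime ds.length N) (q r : CurvePoint (cyclicCurve ds)) (hq : q.HasPole (yFun _))
    (hr : r.HasPole (yFun _)) : q = r := by
  have := isDomain_adjoinRoot_cyclicCurve hN ds hm
  refine CurvePoint.ext_of_mk fun p => ?_
  by_cases hp : cyclicCurve ds ∣ p
  · rw [aevalAeval_yFun_xFun, AdjoinRoot.mk_eq_zero.2 hp]
    simp
  · rw [(q.val_of_pole hN ds hm0 hm hq).2.2 p hp, (r.val_of_pole hN ds hm0 hm hr).2.2 p hp]

theorem exists_curvePoint_pole (hN : 0 < N) (ds : List (Fin N → ℂ))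
    (hm : Nat.Coprime ds.length N) :
    ∃ P : CurvePoint (cyclicCurve ds), P.HasPole (yFun _) := by
  obtain ⟨x, y, hF, hx, hy⟩ := exists_laurentSeries_point_at_infinity hN ds hm
  obtain ⟨hd, ψ, hψ⟩ := exists_ratFun_hom hF (dvd_of_val_exp hN ds hm laurent_val_const hF one_pos
    (by simpa using hx) (by simpa using hy))
  have hψx : ψ (xFun _) = x := by simpa using hψ X
  have hψy : ψ (yFun _) = y := by simpa using hψ (C X)
  obtain ⟨α, β, hαβ⟩ := Nat.isCoprime_iff_coprime.2 hm
  obtain ⟨P, hP⟩ := exists_curvePoint ψ (fun c => by simpa using hψ (C (C c)))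
    -- By Bézout this monomial has order one, which makes the valuation surjective.
    (xFun _ ^ (-α) * yFun _ ^ (-β)) (by
      rw [map_mul, map_mul, map_zpow₀, map_zpow₀, map_zpow₀, map_zpow₀, hψx, hψy, hx, hy,
        ← WithZero.exp_zsmul, ← WithZero.exp_zsmul, ← WithZero.exp_add]
      congr 1
      simp only [smul_eq_mul]
      linarith)
  refine ⟨P, ?_⟩
  rw [CurvePoint.HasPole, hP, hψy, hy, ← WithZero.exp_zero, WithZero.exp_lt_exp]
  exact_mod_cast hN

end PointAtInfinity

/-! ### The local parameter at infinity. -/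

section OneUnits

variable {L : Type*} [Field L] {v : Valuation L ℤᵐ⁰}

theorem val_eq_one_of_val_sub_one_lt {ρ : L} (h : v (ρ - 1) < 1) : v ρ = 1 := by
  rw [← v.map_one] at h
  rw [Valuation.map_eq_of_sub_lt v h, v.map_one]

theorem val_zpow_sub_one_lt {ρ : L} (h : v (ρ - 1) < 1) (n : ℤ) : v (ρ ^ n - 1) < 1 := by
  have h1 := val_eq_one_of_val_sub_one_lt h
  have hρ : ρ ≠ 0 := by
    rintro rfl
    simp at h1
  have hnat : ∀ n : ℕ, v (ρ ^ n - 1) < 1 := by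
    intro n
    induction n with
    | zero => simp
    | succ n ih =>
      rw [show ρ ^ (n + 1) - 1 = ρ ^ n * (ρ - 1) + (ρ ^ n - 1) by ring]
      refine Valuation.map_add_lt v ?_ ih
      rw [map_mul, map_pow, h1, one_pow, one_mul]
      exact h
  obtain ⟨n, rfl | rfl⟩ := n.eq_nat_or_neg
  · simpa using hnat n
  · rw [zpow_neg, zpow_natCast, show (ρ ^ n)⁻¹ - 1 = -((ρ ^ n - 1) * (ρ ^ n)⁻¹) by
      field_simp; ring, Valuation.map_neg, map_mul, map_inv₀, map_pow, h1]
    simpa using hnat n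

/-- With `α m + β N = 1` take `k = x ^ (-α) * y ^ (-β)`. Then `x k ^ m` and `y k ^ N` are the powers
`β` and `-α` of the one-unit `ρ = x ^ N / y ^ m`, so no root has to be extracted. -/
theorem exists_local_parameter {m N : ℕ} (hm : Nat.Coprime m N) {x y : L}
    (hx : v x = WithZero.exp (m : ℤ)) (hy : v y = WithZero.exp (N : ℤ))
    (hxy : v (x ^ N - y ^ m) < v (y ^ m)) :
    ∃ k : L, v k = WithZero.exp (-1 : ℤ) ∧ v (x * k ^ m - 1) < 1 ∧ v (y * k ^ N - 1) < 1 := by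
  obtain ⟨α, β, hαβ⟩ := Nat.isCoprime_iff_coprime.2 hm
  have hx0 : x ≠ 0 := by
    rintro rfl
    rw [map_zero] at hx
    exact WithZero.exp_ne_zero hx.symm
  have hy0 : y ≠ 0 := by
    rintro rfl
    rw [map_zero] at hy
    exact WithZero.exp_ne_zero hy.symm
  have hym : y ^ m ≠ 0 := pow_ne_zero _ hy0
  set ρ := x ^ N / y ^ m with hρ
  have hρ1 : v (ρ - 1) < 1 := by
    rw [hρ, div_sub_one hym, map_div₀, div_lt_one₀ ((Valuation.pos_iff v).2 hym)]
    exact hxy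
  have e : ∀ a b : ℤ, ∀ a' b' : ℤ, a = a' → b = b' → x ^ a * y ^ b = x ^ a' * y ^ b' := by
    rintro a b _ _ rfl rfl; rfl
  have hρz : ∀ n : ℤ, ρ ^ n = x ^ (N * n) * y ^ (-(m * n)) := by
    intro n
    rw [hρ, div_zpow, ← zpow_natCast, ← zpow_natCast, ← zpow_mul, ← zpow_mul, zpow_neg,
      div_eq_mul_inv]
  have hk : ∀ n : ℕ, (x ^ (-α) * y ^ (-β)) ^ n = x ^ (-α * n) * y ^ (-β * n) := by
    intro n
    rw [mul_pow, ← zpow_natCast, ← zpow_natCast, ← zpow_mul, ← zpow_mul]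
  refine ⟨x ^ (-α) * y ^ (-β), ?_, ?_, ?_⟩
  · rw [map_mul, map_zpow₀, map_zpow₀, hx, hy, ← WithZero.exp_zsmul, ← WithZero.exp_zsmul,
      ← WithZero.exp_add]
    congr 1
    simp only [smul_eq_mul]
    linarith
  · have : x * (x ^ (-α) * y ^ (-β)) ^ m = ρ ^ β := by
      rw [hk, hρz, ← mul_assoc, ← zpow_one_add₀ hx0]
      refine e _ _ _ _ ?_ ?_ <;> linarith
    rw [this]
    exact val_zpow_sub_one_lt hρ1 β
  · have : y * (x ^ (-α) * y ^ (-β)) ^ N = ρ ^ (-α) := by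
      rw [hk, hρz, mul_left_comm, ← zpow_one_add₀ hy0]
      refine e _ _ _ _ ?_ ?_ <;> linarith
    rw [this]
    exact val_zpow_sub_one_lt hρ1 _

end OneUnits

/-! ### Asymptotics of eigenvectors at infinity. -/

section Eigenvectors

variable {L : Type*} [Field L] [Algebra ℂ L] {v : Valuation L ℤᵐ⁰} {N : ℕ}

/-- In the residue field `k` becomes `0` while `η` and `ξ` become `1`, so the reduced vector is
fixed by `S(1) ^ m` and therefore constant. -/
theorem val_sub_lt_one_of_mulVec_eq (hv : ∀ c : ℂ, c ≠ 0 → v (algebraMap ℂ L c) = 1)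
    (ds : List (Fin N → ℂ)) (hm : Nat.Coprime ds.length N) {k η ξ : L} (hk : v k < 1)
    (hη : v (η - 1) < 1) (hξ : v (ξ - 1) < 1) {u : Fin N → L} (hu : ∀ i, v (u i) ≤ 1)
    (h : (cyclicProd (ds.map fun d i => k * algebraMap ℂ L (d i)) η).mulVec u = ξ • u)
    (i j : Fin N) : v (u i - u j) < 1 := by
  set O := v.valuationSubring with hO
  have hres : ∀ a : O, IsLocalRing.residue O a = 0 ↔ v (a : L) < 1 := by
    intro a
    rw [IsLocalRing.residue_eq_zero_iff]
    exact Valuation.mem_maximalIdeal_iff _ v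
  set k' : O := ⟨k, hk.le⟩ with hk'
  set η' : O := ⟨η, (val_eq_one_of_val_sub_one_lt hη).le⟩ with hη'
  set ξ' : O := ⟨ξ, (val_eq_one_of_val_sub_one_lt hξ).le⟩ with hξ'
  set u' : Fin N → O := fun i => ⟨u i, hu i⟩ with hu'
  set es : List (Fin N → O) := ds.map fun d i => k' * ⟨algebraMap ℂ L (d i),
    val_const_le_one hv (d i)⟩ with hes
  have h1 : (cyclicProd es η').mulVec u' = ξ' • u' := by
    have hinj : Function.Injective (O.subtype) := Subtype.val_injective
    funext l
    apply hinj
    have e := RingHom.map_mulVec O.subtype (cyclicProd es η') u' l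
    rw [e, cyclicProd_map, hes, List.map_map]
    exact congrFun h l
  have h2 : (cyclicBidiagonal (0 : Fin N → IsLocalRing.ResidueField O) 1 ^ ds.length).mulVec
      (fun i => IsLocalRing.residue O (u' i)) = fun i => IsLocalRing.residue O (u' i) := by
    funext l
    have e := RingHom.map_mulVec (IsLocalRing.residue O) (cyclicProd es η') u' l
    have hη1 : IsLocalRing.residue O η' = 1 := by
      rw [← sub_eq_zero, ← map_one (IsLocalRing.residue O), ← map_sub, hres]
      exact hη
    have hξ1 : IsLocalRing.residue O ξ' = 1 := by
      rw [← sub_eq_zero, ← map_one (IsLocalRing.residue O), ← map_sub, hres]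
      exact hξ
    have hk1 : IsLocalRing.residue O k' = 0 := (hres k').2 hk
    rw [h1, cyclicProd_map, hη1, cyclicProd_zero, Pi.smul_apply, smul_eq_mul, map_mul, hξ1,
      one_mul, List.length_map, hes, List.length_map] at e
    · exact e.symm
    · intro d hd
      simp only [hes, List.mem_map, exists_exists_and_eq_and] at hd
      obtain ⟨d', -, rfl⟩ := hd
      funext i
      rw [map_mul, hk1, zero_mul]
      rfl
  have h3 := eq_of_cyclicBidiagonal_zero_one_pow_mulVec hm _ h2 i j
  rw [← sub_eq_zero, ← map_sub, hres] at h3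
  exact h3

theorem exists_scaling_of_eigenvector (hv : ∀ c : ℂ, c ≠ 0 → v (algebraMap ℂ L c) = 1)
    (hN : 0 < N) (ds : List (Fin N → ℂ)) (hm : Nat.Coprime ds.length N) {x y k : L}
    (hk0 : k ≠ 0) (hk : v k < 1) (hx : v (x * k ^ ds.length - 1) < 1) (hy : v (y * k ^ N - 1) < 1)
    {w : Fin N → L} (hw0 : w ≠ 0)
    (hw : (cyclicProd (ds.map fun d i => algebraMap ℂ L (d i)) y).mulVec w = x • w) :
    ∃ c : L, c ≠ 0 ∧ ∀ i : Fin N, v (c * w i - k ^ (N - 1 - (i : ℕ))) < v (k ^ (N - 1 - (i : ℕ))) := by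
  have hkz : k * k⁻¹ = 1 := mul_inv_cancel₀ hk0
  set D : Matrix (Fin N) (Fin N) L := Matrix.diagonal fun i => k⁻¹ ^ (i : ℕ) with hD
  set u : Fin N → L := fun i => k ^ (i : ℕ) * w i with hu
  have hDu : D.mulVec u = w := by
    funext i
    rw [hD, Matrix.mulVec_diagonal, hu]
    simp only
    rw [← mul_assoc, ← mul_pow, inv_mul_cancel₀ hk0, one_pow, one_mul]
  have hconj := cyclicProd_mul_diagonal hkz (ds.map fun d i => algebraMap ℂ L (d i)) y
  rw [List.map_map, List.length_map, ← hD] at hconj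
  have hYu : (cyclicProd (ds.map fun d i => k * algebraMap ℂ L (d i)) (y * k ^ N)).mulVec u =
      (x * k ^ ds.length) • u := by
    have h1 := congrArg (fun A => A.mulVec u) hconj
    simp only [← Matrix.mulVec_mulVec, Matrix.smul_mulVec, hDu, hw] at h1
    funext i
    have h2 := congrFun h1 i
    rw [Pi.smul_apply, Pi.smul_apply, hD, Matrix.mulVec_diagonal, smul_eq_mul, smul_eq_mul] at h2
    have hw' : w i = k⁻¹ ^ (i : ℕ) * u i := by
      rw [← hDu, hD, Matrix.mulVec_diagonal]
    rw [hw'] at h2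
    rw [Pi.smul_apply, smul_eq_mul]
    change _ = k⁻¹ ^ ds.length * (k⁻¹ ^ (i : ℕ) * (cyclicProd (ds.map fun d i =>
      k * algebraMap ℂ L (d i)) (y * k ^ N)).mulVec u i) at h2
    rw [inv_pow, inv_pow] at h2
    have hk1 : k ^ (i : ℕ) ≠ 0 := pow_ne_zero _ hk0
    have hk2 : k ^ ds.length ≠ 0 := pow_ne_zero _ hk0
    field_simp at h2
    rw [← h2]; ring
  have : Nonempty (Fin N) := ⟨⟨0, hN⟩⟩
  -- Division by an entry of largest value makes the vector integral with one entry equal to `1`; by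
  -- the congruence all its entries are then units.
  obtain ⟨i₀, -, hi₀⟩ := Finset.exists_max_image Finset.univ (fun i => v (u i))
    Finset.univ_nonempty
  have hui₀ : u i₀ ≠ 0 := by
    intro h0
    apply hw0
    have : u = 0 := by
      funext i
      have := hi₀ i (Finset.mem_univ i)
      rw [h0, map_zero, le_zero_iff, Valuation.zero_iff] at this
      exact this
    rw [← hDu, this, Matrix.mulVec_zero]
  have hclose := val_sub_lt_one_of_mulVec_eq (u := (u i₀)⁻¹ • u) hv ds hm hk hy hx
    (fun i => by
      rw [Pi.smul_apply, smul_eq_mul, map_mul, map_inv₀]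
      exact inv_mul_le_one_of_le₀ (hi₀ i (Finset.mem_univ i)) zero_le)
    (by rw [Matrix.mulVec_smul, hYu, smul_comm])
  have hone : ∀ i, v ((u i₀)⁻¹ * u i) = 1 := by
    intro i
    apply val_eq_one_of_val_sub_one_lt
    have := hclose i i₀
    simpa [inv_mul_cancel₀ hui₀] using this
  have hu0 : ∀ i, u i ≠ 0 := by
    intro i h0
    have := hone i
    rw [h0, mul_zero, map_zero] at this
    exact zero_ne_one this
  set l : Fin N := ⟨N - 1, by omega⟩ with hl
  have hwu : ∀ i, w i = (k ^ (i : ℕ))⁻¹ * u i := by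
    intro i
    rw [← hDu, hD, Matrix.mulVec_diagonal, inv_pow]
  have hwl : w l ≠ 0 := by
    rw [hwu]
    exact mul_ne_zero (inv_ne_zero (pow_ne_zero _ hk0)) (hu0 l)
  -- Normalising the last entry to `1` gives `w i / w l = k ^ (N - 1 - i) * (u i / u l)`, and the
  -- last quotient is a one-unit.
  refine ⟨(w l)⁻¹, inv_ne_zero hwl, fun i => ?_⟩
  have hkn : k ^ (N - 1 - (i : ℕ)) ≠ 0 := pow_ne_zero _ hk0
  have hsplit : k ^ (N - 1) = k ^ (N - 1 - (i : ℕ)) * k ^ (i : ℕ) := by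
    rw [← pow_add]; congr 1; omega
  have e1 : (w l)⁻¹ * w i - k ^ (N - 1 - (i : ℕ)) =
      k ^ (N - 1 - (i : ℕ)) * (((u i₀)⁻¹ * u i - (u i₀)⁻¹ * u l) * ((u i₀)⁻¹ * u l)⁻¹) := by
    rw [hwu, hwu]
    change ((k ^ (N - 1))⁻¹ * u l)⁻¹ * _ - _ = _
    rw [hsplit]
    have := hu0 l
    have : k ^ (i : ℕ) ≠ 0 := pow_ne_zero _ hk0
    field_simp
  rw [e1, map_mul, map_mul, map_inv₀, hone l, inv_one, mul_one]
  have hpos : 0 < v (k ^ (N - 1 - (i : ℕ))) := (Valuation.pos_iff v).2 hkn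
  have := mul_lt_mul_of_pos_left (hclose i l) hpos
  simpa using this

end Eigenvectors

/-! ### The Lax matrix over the function field. -/

section Map

variable {M K N : ℕ} {I V : ℤ → ℤ → ℂ} {F : ℂ[X][X]}

theorem laxMatrix_map (s : ℤ) : (laxMatrix M K N I V s).map (algebraMap ℂ[X] (RatFun F)) =
    cyclicProd ((laxDiagonals M K N I V s).map fun d i => algebraMap ℂ (RatFun F) (d i))
      (yFun F) := by
  rw [laxMatrix_eq_cyclicProd, cyclicProd_map, List.map_map]
  rfl

theorem exists_isEigenvector [IsDomain (AdjoinRoot F)] (s : ℤ)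
    (hF : F = spectralPoly M K N I V s) :
    ∃ w : Fin N → RatFun F, IsEigenvector F (laxMatrix M K N I V s) w := by
  have hdet : (Matrix.scalar (Fin N) (xFun F) -
      (laxMatrix M K N I V s).map (algebraMap ℂ[X] (RatFun F))).det = 0 := by
    rw [← Matrix.eval_charpoly, Matrix.charpoly_map, eval_map]
    change eval₂ _ _ (spectralPoly M K N I V s) = 0
    rw [← hF, ← aevalAeval_yFun_xFun_self (F := F)]
    conv_lhs => rw [eval₂_eq_sum_range' _ (Nat.lt_succ_self _)]
    rw [aevalAeval_eq_sum _ _ _ (Nat.lt_succ_self _)]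
    refine Finset.sum_congr rfl fun a _ => ?_
    rw [← aevalAeval_C (yFun F) (xFun F), aevalAeval_yFun_xFun]
    rfl
  obtain ⟨w, hw0, hw⟩ := Matrix.exists_mulVec_eq_zero_iff.2 hdet
  refine ⟨w, hw0, ?_⟩
  rw [Matrix.sub_mulVec, sub_eq_zero] at hw
  rw [← hw]
  ext i
  simp [Matrix.scalar_apply, Matrix.mulVec_diagonal]

end Map

/-! ### Exchanging the roles of `x` and `y`. -/

section Swap

open Polynomial.Bivariate

theorem evalEval_swap (a b : ℂ) (G : ℂ[X][X]) : (swap G).evalEval a b = G.evalEval b a := by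
  have := aevalAeval_swap (R := ℂ) a b G
  rwa [coe_aevalAeval_eq_evalEval, coe_aevalAeval_eq_evalEval] at this

theorem swap_map_evalRingHom (a : ℂ) (G : ℂ[X][X]) :
    (swap G).map (evalRingHom a) = G.eval (C a) := by
  refine congrArg (fun f : ℂ[X][X] →+* ℂ[X] => f G) (?_ : (mapRingHom (evalRingHom a)).comp
    (swap (R := ℂ) : ℂ[X][X] →+* ℂ[X][X]) = evalRingHom (C a))
  refine Polynomial.ringHom_ext' (Polynomial.ringHom_ext (fun c => ?_) ?_) ?_ <;>
    simp [swap_C, swap_Y]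

theorem swap_eval_C (b : ℂ) (G : ℂ[X][X]) :
    (swap G).eval (C b) = G.map (evalRingHom b) := by
  rw [← swap_map_evalRingHom, swap_swap_apply]

theorem coeff_coeff_swap (G : ℂ[X][X]) (a b : ℕ) :
    ((swap G).coeff b).coeff a = (G.coeff a).coeff b := by
  induction G using Polynomial.induction_on' with
  | add p q hp hq => simp [hp, hq]
  | monomial n f =>
    induction f using Polynomial.induction_on' with
    | add p q hp hq => simp only [map_add, coeff_add, hp, hq]
    | monomial k c =>
      rw [swap_monomial_monomial]
      simp only [coeff_monomial]
      by_cases h1 : n = a <;> by_cases h2 : k = b <;> simp [h1, h2, coeff_monomial]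

/-- The sign is there because `F = x ^ N - y ^ m + …` has leading coefficient `-1` in `y`. -/
theorem IsSmoothAffine.neg_swap {F : ℂ[X][X]} (h : IsSmoothAffine F) :
    IsSmoothAffine (-swap F) := by
  intro a b hab
  rw [evalEval_neg, neg_eq_zero, evalEval_swap] at hab
  rw [Polynomial.map_neg, eval_neg, swap_eval_C, swap_map_evalRingHom]
  simpa using (h b a hab).symm

end Swap

/-! ### First order expansion at a point. -/

section Taylor

theorem exists_taylor (G : ℂ[X][X]) (a b : ℂ) :
    ∃ (G₁ : ℂ[X][X]) (G₂ : ℂ[X]),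
      G = C (C (G.evalEval b a)) + (X - C (C a)) * G₁ + C ((X - C b) * G₂) ∧
      G = C (G.eval (C a)) + (X - C (C a)) * G₁ ∧
      G₁.evalEval b a = (derivative (G.map (evalRingHom b))).eval a ∧
      G₂.eval b = (derivative (G.eval (C a))).eval b := by
  obtain ⟨G₁, h₁⟩ : X - C (C a) ∣ G - C (G.eval (C a)) := X_sub_C_dvd_sub_C_eval
  obtain ⟨G₂, h₂⟩ : X - C b ∣ G.eval (C a) - C ((G.eval (C a)).eval b) := X_sub_C_dvd_sub_C_eval
  refine ⟨G₁, G₂, ?_, ?_, ?_, ?_⟩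
  · rw [← h₂, ← h₁, C_sub]
    ring
  · rw [← h₁]; ring
  · have h3 := congrArg (fun p => (derivative (p.map (evalRingHom b))).eval a) h₁
    simp only [Polynomial.map_sub, Polynomial.map_mul, map_C, map_X, coe_evalRingHom, eval_C,
      derivative_sub, derivative_C, sub_zero, derivative_mul, derivative_X, one_mul, eval_add,
      eval_mul, eval_sub, eval_X, sub_self, zero_mul, add_zero] at h3
    rw [h3, map_evalRingHom_eval]
  · have h3 := congrArg (fun p => (derivative p).eval b) h₂
    simpa using h3.symm

end Taylor

/-! ### Orders of functions at smooth affine points. -/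

section AffineValuations

variable {L : Type*} [Field L] [Algebra ℂ L] {v : Valuation L ℤᵐ⁰} {x y : L} {a b : ℂ}

theorem val_le_one_of_val_sub_const_lt (hv : ∀ c : ℂ, c ≠ 0 → v (algebraMap ℂ L c) = 1)
    (hx : v (x - algebraMap ℂ L a) < 1) : v x ≤ 1 := by
  rw [← sub_add_cancel x (algebraMap ℂ L a)]
  exact Valuation.map_add_le v hx.le (val_const_le_one hv a)

theorem val_aeval_le_one (hv : ∀ c : ℂ, c ≠ 0 → v (algebraMap ℂ L c) = 1) (hy : v y ≤ 1)
    (p : ℂ[X]) : v (aeval y p) ≤ 1 := by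
  rw [aeval_eq_sum_range]
  refine Valuation.map_sum_le v fun i _ => ?_
  rw [Algebra.smul_def, map_mul, map_pow]
  exact mul_le_one' (val_const_le_one hv _) (pow_le_one' hy _)

theorem val_aevalAeval_le_one (hv : ∀ c : ℂ, c ≠ 0 → v (algebraMap ℂ L c) = 1) (hx : v x ≤ 1)
    (hy : v y ≤ 1) (p : ℂ[X][X]) : v (aevalAeval y x p) ≤ 1 := by
  rw [aevalAeval_eq_sum x y p (Nat.lt_succ_self _)]
  refine Valuation.map_sum_le v fun i _ => ?_
  rw [map_mul, map_pow]
  exact mul_le_one' (val_aeval_le_one hv hy _) (pow_le_one' hx _)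

theorem val_aevalAeval_sub_lt (hv : ∀ c : ℂ, c ≠ 0 → v (algebraMap ℂ L c) = 1)
    (hx : v (x - algebraMap ℂ L a) < 1) (hy : v (y - algebraMap ℂ L b) < 1) (G : ℂ[X][X]) :
    v (aevalAeval y x G - algebraMap ℂ L (G.evalEval b a)) < 1 := by
  obtain ⟨G₁, G₂, hG, -⟩ := exists_taylor G a b
  have hx1 := val_le_one_of_val_sub_const_lt hv hx
  have hy1 := val_le_one_of_val_sub_const_lt hv hy
  have e : aevalAeval y x G - algebraMap ℂ L (G.evalEval b a) =
      (x - algebraMap ℂ L a) * aevalAeval y x G₁ + (y - algebraMap ℂ L b) * aeval y G₂ := by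
    generalize G.evalEval b a = c at hG
    rw [hG]
    simp
    ring
  rw [e]
  refine Valuation.map_add_lt v ?_ ?_
  · rw [map_mul]
    exact mul_lt_one_of_lt_of_le hx (val_aevalAeval_le_one hv hx1 hy1 _)
  · rw [map_mul]
    exact mul_lt_one_of_lt_of_le hy (val_aeval_le_one hv hy1 _)

theorem val_aevalAeval_eq_one (hv : ∀ c : ℂ, c ≠ 0 → v (algebraMap ℂ L c) = 1)
    (hx : v (x - algebraMap ℂ L a) < 1) (hy : v (y - algebraMap ℂ L b) < 1) {G : ℂ[X][X]}
    (hG : G.evalEval b a ≠ 0) : v (aevalAeval y x G) = 1 := by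
  have h := val_aevalAeval_sub_lt hv hx hy G
  rw [← hv _ hG] at h ⊢
  exact Valuation.map_eq_of_sub_lt v h

theorem evalEval_eq_zero_of_aevalAeval (hv : ∀ c : ℂ, c ≠ 0 → v (algebraMap ℂ L c) = 1)
    (hx : v (x - algebraMap ℂ L a) < 1) (hy : v (y - algebraMap ℂ L b) < 1) {G : ℂ[X][X]}
    (hG : aevalAeval y x G = 0) : G.evalEval b a = 0 := by
  by_contra h
  have := val_aevalAeval_eq_one hv hx hy h
  rw [hG, map_zero] at this
  exact zero_ne_one this

/-- At a point where `∂F/∂x` does not vanish, `y - b` is a local parameter. -/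
theorem exists_mul_eq_mul_pow (hv : ∀ c : ℂ, c ≠ 0 → v (algebraMap ℂ L c) = 1)
    (hx : v (x - algebraMap ℂ L a) < 1) (hy : v (y - algebraMap ℂ L b) < 1) {F : ℂ[X][X]}
    (hF : aevalAeval y x F = 0) (hFx : (derivative (F.map (evalRingHom b))).eval a ≠ 0)
    (g : ℂ[X][X]) (hg : aevalAeval y x g ≠ 0) :
    ∃ (n : ℕ) (s u : ℂ[X][X]), s.evalEval b a ≠ 0 ∧ u.evalEval b a ≠ 0 ∧
      aevalAeval y x s * aevalAeval y x g = aevalAeval y x u * (y - algebraMap ℂ L b) ^ n := by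
  have hx1 := val_le_one_of_val_sub_const_lt hv hx
  have hy1 := val_le_one_of_val_sub_const_lt hv hy
  obtain ⟨G₁, G₂, hFt, -, hG₁, -⟩ := exists_taylor F a b
  rw [← hG₁] at hFx
  rw [evalEval_eq_zero_of_aevalAeval hv hx hy hF] at hFt
  have hFe : (x - algebraMap ℂ L a) * aevalAeval y x G₁ + (y - algebraMap ℂ L b) * aeval y G₂ = 0 := by
    rw [← hF]
    conv_rhs => rw [hFt]
    simp
  -- Induction on the order of `g`; each round splits off one factor `y - b`.
  induction hn : (-WithZero.log (v (aevalAeval y x g))).toNat using Nat.strong_induction_on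
    generalizing g with
  | _ n ih =>
    by_cases hg0 : g.evalEval b a = 0
    · obtain ⟨g₁, g₂, hgt, -⟩ := exists_taylor g a b
      rw [hg0] at hgt
      -- Eliminates `x - a` between the expansions of `F` and `g`. The multiplier `G₁` takes the
      -- nonzero value `∂F/∂x` at the point.
      set g' : ℂ[X][X] := G₁ * C g₂ - C G₂ * g₁ with hg'
      have hge : aevalAeval y x G₁ * aevalAeval y x g =
          (y - algebraMap ℂ L b) * aevalAeval y x g' := by
        have : aevalAeval y x g =
            (x - algebraMap ℂ L a) * aevalAeval y x g₁ + (y - algebraMap ℂ L b) * aeval y g₂ := by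
          conv_lhs => rw [hgt]
          simp
        rw [this, hg', map_sub, map_mul, map_mul, aevalAeval_C, aevalAeval_C]
        linear_combination aevalAeval y x g₁ * hFe
      have hvG₁ := val_aevalAeval_eq_one hv hx hy hFx
      have hve : v (aevalAeval y x g) = v (y - algebraMap ℂ L b) * v (aevalAeval y x g') := by
        rw [← map_mul, ← hge, map_mul, hvG₁, one_mul]
      have hvg : v (aevalAeval y x g) ≠ 0 := (Valuation.ne_zero_iff v).2 hg
      have hvy : v (y - algebraMap ℂ L b) ≠ 0 := fun h => hvg (by rw [hve, h, zero_mul])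
      have hvg' : v (aevalAeval y x g') ≠ 0 := fun h => hvg (by rw [hve, h, mul_zero])
      have hlog := WithZero.log_mul hvy hvg'
      rw [← hve] at hlog
      have hlogy : WithZero.log (v (y - algebraMap ℂ L b)) < 0 := by
        rw [← WithZero.exp_lt_exp, WithZero.exp_log hvy, WithZero.exp_zero]
        exact hy
      have hlogg' : WithZero.log (v (aevalAeval y x g')) ≤ 0 := by
        rw [← WithZero.exp_le_exp, WithZero.exp_log hvg', WithZero.exp_zero]
        exact val_aevalAeval_le_one hv hx1 hy1 g'
      obtain ⟨n', s, u, hs, hu, hsu⟩ := ih _ (by omega) g' ((Valuation.ne_zero_iff v).1 hvg') rfl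
      refine ⟨n' + 1, s * G₁, u, ?_, hu, ?_⟩
      · rw [evalEval_mul]
        exact mul_ne_zero hs hFx
      · rw [map_mul, mul_assoc, hge, mul_left_comm, hsu, pow_succ]
        ring
    · exact ⟨0, 1, g, by simp, hg0, by simp⟩

/-- The order of `x - a` at a smooth point `(a, b)`. -/
theorem val_sub_eq_exp_rootMultiplicity (hv : ∀ c : ℂ, c ≠ 0 → v (algebraMap ℂ L c) = 1)
    (hx : v (x - algebraMap ℂ L a) < 1) (hy : v (y - algebraMap ℂ L b) < 1) {F : ℂ[X][X]}
    (hF : aevalAeval y x F = 0) (hsm : IsSmoothAffine F) (hF0 : F.eval (C a) ≠ 0)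
    (hFx : (derivative (F.map (evalRingHom b))).eval a ≠ 0 →
      v (y - algebraMap ℂ L b) = WithZero.exp (-1 : ℤ))
    (hFy : (derivative (F.eval (C a))).eval b ≠ 0 →
      v (x - algebraMap ℂ L a) = WithZero.exp (-1 : ℤ)) :
    v (x - algebraMap ℂ L a) = WithZero.exp (-((F.eval (C a)).rootMultiplicity b : ℤ)) := by
  have hFab := evalEval_eq_zero_of_aevalAeval hv hx hy hF
  obtain ⟨G₁, G₂, -, hFt, hG₁, -⟩ := exists_taylor F a b
  set f := F.eval (C a) with hf
  by_cases hd : (derivative (F.map (evalRingHom b))).eval a = 0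
  -- Here `∂F/∂y` is nonzero, so `b` is a simple root and `x - a` a local parameter. In the other
  -- case `F(a, y)` equals `x - a` up to a unit, and `y - b` is a local parameter.
  · have hd2 := (hsm a b hFab).resolve_left (fun h => h hd)
    rw [hFy hd2]
    have h1 : 0 < f.rootMultiplicity b := (rootMultiplicity_pos hF0).2 hFab
    have h2 : ¬ 1 < f.rootMultiplicity b := by
      rw [one_lt_rootMultiplicity_iff_isRoot hF0]
      exact fun h => hd2 h.2
    rw [show f.rootMultiplicity b = 1 by omega]
    simp
  · have hvG₁ := val_aevalAeval_eq_one (G := G₁) hv hx hy (by rw [hG₁]; exact hd)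
    have e : aeval y f = -((x - algebraMap ℂ L a) * aevalAeval y x G₁) := by
      have : aevalAeval y x F = aeval y f + (x - algebraMap ℂ L a) * aevalAeval y x G₁ := by
        conv_lhs => rw [hFt]
        simp
      rw [hF] at this
      linear_combination -this
    have e2 : v (aeval y f) = v (x - algebraMap ℂ L a) := by
      rw [e, Valuation.map_neg, map_mul, hvG₁, mul_one]
    obtain ⟨g, hg, hgd⟩ := exists_eq_pow_rootMultiplicity_mul_and_not_dvd f hF0 b
    have hgb : g.eval b ≠ 0 := fun h => hgd (dvd_iff_isRoot.2 h)
    have hvg : v (aeval y g) = 1 := by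
      have := val_aevalAeval_eq_one (G := C g) hv hx hy (by rw [evalEval_C]; exact hgb)
      rwa [aevalAeval_C] at this
    rw [← e2]
    conv_lhs => rw [hg]
    rw [map_mul, map_mul, hvg, mul_one, map_pow, map_pow, map_sub, aeval_X, aeval_C, hFx hd,
      ← WithZero.exp_nsmul]
    simp

end AffineValuations

/-! ### Existence and uniqueness of affine points. -/

section AffinePoints

variable {F : ℂ[X][X]}

theorem eq_algebraMap_of_aeval_eq_zero {L : Type*} [Field L] [Algebra ℂ L] {y : L} {p : ℂ[X]}
    (hp : p ≠ 0) (h : aeval y p = 0) : ∃ c : ℂ, y = algebraMap ℂ L c := by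
  have hs := (IsAlgClosed.splits p).eq_prod_roots
  rw [hs, map_mul, aeval_C, map_multiset_prod, mul_eq_zero] at h
  rcases h with h | h
  · rw [map_eq_zero] at h
    exact absurd (leadingCoeff_eq_zero.1 h) hp
  · rw [Multiset.prod_eq_zero_iff] at h
    simp only [Multiset.map_map, Multiset.mem_map, Function.comp] at h
    obtain ⟨c, -, hc⟩ := h
    refine ⟨c, ?_⟩
    rwa [map_sub, aeval_X, aeval_C, sub_eq_zero] at hc

/-- A nonconstant point of the curve in an extension field is generic. -/
theorem dvd_of_aevalAeval_eq_zero [IsDomain (AdjoinRoot F)] (hmon : F.Monic) {L : Type*} [Field L]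
    [Algebra ℂ L] {x y : L} (hF : aevalAeval y x F = 0)
    (hxy : ¬ ∃ c d : ℂ, x = algebraMap ℂ L c ∧ y = algebraMap ℂ L d) (p : ℂ[X][X])
    (hp : aevalAeval y x p = 0) : F ∣ p := by
  by_contra hne
  set φ : AdjoinRoot F →+* L := Ideal.Quotient.lift (Ideal.span {F}) (aevalAeval y x).toRingHom
    (by
      intro a ha
      obtain ⟨b, rfl⟩ := Ideal.mem_span_singleton.1 ha
      change aevalAeval y x (F * b) = 0
      rw [map_mul, hF, zero_mul]) with hφ
  have hfin : Module.Finite ℂ[X] (AdjoinRoot F) := hmon.finite_adjoinRoot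
  -- Since the coordinate ring is integral over `ℂ[y]`, a nonzero kernel contains a nonzero
  -- polynomial in `y`. Then `y`, and through the monic `F` also `x`, is algebraic over `ℂ`, hence
  -- constant.
  have hcomap := Ideal.comap_ne_bot_of_integral_mem (R := ℂ[X]) (I := RingHom.ker φ)
    (x := AdjoinRoot.mk F p) (fun h => hne (AdjoinRoot.mk_eq_zero.1 h)) hp
    (Algebra.IsIntegral.isIntegral _)
  obtain ⟨h, hh, hh0⟩ := Submodule.exists_mem_ne_zero_of_ne_bot hcomap
  have hy : aeval y h = 0 := by
    rw [← aevalAeval_C y x]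
    exact hh
  obtain ⟨d, hd⟩ := eq_algebraMap_of_aeval_eq_zero hh0 hy
  have hx : aeval x (F.map (evalRingHom d)) = 0 := by
    rw [← hF, aevalAeval_eq_sum x y F (Nat.lt_succ_self _), aeval_def, eval₂_map,
      eval₂_eq_sum_range]
    refine Finset.sum_congr rfl fun a _ => ?_
    rw [hd, aeval_algebraMap_apply]
    simp
  obtain ⟨c, hc⟩ := eq_algebraMap_of_aeval_eq_zero (hmon.map _).ne_zero hx
  exact hxy ⟨c, d, hc, hd⟩

theorem exists_powerSeries_point (hmon : F.Monic) {a b : ℂ} (h0 : F.evalEval b a = 0)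
    (h1 : (derivative (F.map (evalRingHom b))).eval a ≠ 0) :
    ∃ ξ : PowerSeries ℂ, aevalAeval (PowerSeries.C b + PowerSeries.X) ξ F = 0 ∧
      PowerSeries.constantCoeff ξ = a := by
  set θ : ℂ[X] →+* PowerSeries ℂ :=
    (aeval (PowerSeries.C b + PowerSeries.X : PowerSeries ℂ)).toRingHom with hθ
  have hc : (F.map θ).map (PowerSeries.constantCoeff (R := ℂ)) = F.map (evalRingHom b) := by
    rw [Polynomial.map_map]
    congr 1
    refine Polynomial.ringHom_ext (fun c => ?_) ?_
    · simp [hθ, PowerSeries.algebraMap_eq]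
    · simp [hθ]
  obtain ⟨ξ, h2, h3⟩ := exists_powerSeries_root (hmon.map θ) (c := a)
    (by rw [hc, map_evalRingHom_eval]; exact h0) (by rw [hc]; exact h1)
  refine ⟨ξ, ?_, h3⟩
  rw [← h2, eval_map]
  refine congrArg (fun f : ℂ[X][X] →+* PowerSeries ℂ => f F)
    (?_ : (aevalAeval (PowerSeries.C b + PowerSeries.X) ξ).toRingHom = eval₂RingHom θ ξ)
  refine Polynomial.ringHom_ext' (Polynomial.ringHom_ext (fun c => ?_) ?_) ?_ <;> simp [hθ]

/-- The condition `hunif` serves twice: it makes the point nonconstant, hence generic, and provides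
a function of order one. -/
theorem exists_curvePoint_of_powerSeries [IsDomain (AdjoinRoot F)] (hmon : F.Monic) {a b : ℂ}
    {ξ η : PowerSeries ℂ} (hF : aevalAeval η ξ F = 0)
    (hξ : PowerSeries.constantCoeff ξ = a) (hη : PowerSeries.constantCoeff η = b)
    (hunif : ξ = PowerSeries.C a + PowerSeries.X ∨ η = PowerSeries.C b + PowerSeries.X) :
    ∃ P : CurvePoint F, P.HasValue (xFun F) a ∧ P.HasValue (yFun F) b := by
  set ι := HahnSeries.ofPowerSeries ℤ ℂ with hι
  have hFι : aevalAeval (ι η) (ι ξ) F = 0 := by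
    rw [hι, laurent_aevalAeval_coe, hF, map_zero]
  have hιinj : Function.Injective ι := HahnSeries.ofPowerSeries_injective
  have hnc : ∀ c d : ℂ, PowerSeries.C c + PowerSeries.X ≠ PowerSeries.C d := by
    intro c d h
    have := congrArg (PowerSeries.coeff 1) h
    simp at this
  obtain ⟨-, ψ, hψ⟩ := exists_ratFun_hom hFι (dvd_of_aevalAeval_eq_zero hmon hFι (by
    rintro ⟨c, d, hc, hd⟩
    rw [laurent_algebraMap] at hc hd
    rcases hunif with rfl | rfl
    · exact hnc _ _ (hιinj hc)
    · exact hnc _ _ (hιinj hd)))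
  have hψx : ψ (xFun _) = ι ξ := by simpa using hψ X
  have hψy : ψ (yFun _) = ι η := by simpa using hψ (C X)
  have hψc : ∀ c, ψ (algebraMap ℂ (RatFun F) c) = algebraMap ℂ (LaurentSeries ℂ) c :=
    fun c => by simpa using hψ (C (C c))
  have hX : Valued.v (ι PowerSeries.X) = WithZero.exp (-1 : ℤ) := by
    rw [hι, PowerSeries.coe_X, LaurentSeries.valuation_single_zpow]
  obtain ⟨f, hf⟩ : ∃ f : RatFun F, Valued.v (ψ f) = WithZero.exp (-1 : ℤ) := by
    rcases hunif with h | h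
    · refine ⟨xFun F - algebraMap ℂ _ a, ?_⟩
      rw [map_sub, hψx, hψc, laurent_algebraMap, ← map_sub, h, add_sub_cancel_left, hX]
    · refine ⟨yFun F - algebraMap ℂ _ b, ?_⟩
      rw [map_sub, hψy, hψc, laurent_algebraMap, ← map_sub, h, add_sub_cancel_left, hX]
  obtain ⟨P, hP⟩ := exists_curvePoint ψ hψc f hf
  refine ⟨P, ?_, ?_⟩
  · rw [CurvePoint.HasValue, hP, map_sub, hψx, hψc, laurent_algebraMap, ← map_sub,
      laurent_val_coe_lt_one_iff]
    simp [hξ]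
  · rw [CurvePoint.HasValue, hP, map_sub, hψy, hψc, laurent_algebraMap, ← map_sub,
      laurent_val_coe_lt_one_iff]
    simp [hη]

theorem exists_curvePoint_hasValue [IsDomain (AdjoinRoot F)] (hmon : F.Monic)
    (hmon' : (-Bivariate.swap F).Monic) (hsm : IsSmoothAffine F) {a b : ℂ}
    (h0 : F.evalEval b a = 0) :
    ∃ P : CurvePoint F, P.HasValue (xFun F) a ∧ P.HasValue (yFun F) b := by
  rcases hsm a b h0 with h1 | h1
  · obtain ⟨ξ, h2, h3⟩ := exists_powerSeries_point hmon h0 h1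
    exact exists_curvePoint_of_powerSeries hmon h2 h3 (by simp) (Or.inr rfl)
  · obtain ⟨η, h2, h3⟩ := exists_powerSeries_point hmon' (a := b) (b := a)
      (by rw [evalEval_neg, evalEval_swap, h0, neg_zero])
      (by rw [Polynomial.map_neg, swap_map_evalRingHom, derivative_neg, eval_neg]
          exact neg_ne_zero.2 h1)
    rw [map_neg, Bivariate.aevalAeval_swap, neg_eq_zero] at h2
    exact exists_curvePoint_of_powerSeries hmon h2 (by simp) h3 (Or.inl rfl)

/-- At a smooth point there is a local parameter: a function `π` such that every regular function
is a power of `π` times a quotient of functions which do not vanish at the point. -/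
theorem exists_local_factorisation [IsDomain (AdjoinRoot F)] {a b : ℂ} {π : RatFun F}
    (hπ : ((derivative (F.map (evalRingHom b))).eval a ≠ 0 ∧ π = yFun F - algebraMap ℂ _ b) ∨
      ((derivative (F.eval (C a))).eval b ≠ 0 ∧ π = xFun F - algebraMap ℂ _ a))
    (q : CurvePoint F) (hx : q.HasValue (xFun F) a) (hy : q.HasValue (yFun F) b) (g : ℂ[X][X])
    (hg : ¬ F ∣ g) :
    ∃ (n : ℕ) (s u : ℂ[X][X]), s.evalEval b a ≠ 0 ∧ u.evalEval b a ≠ 0 ∧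
      aevalAeval (yFun F) (xFun F) s * aevalAeval (yFun F) (xFun F) g =
        aevalAeval (yFun F) (xFun F) u * π ^ n := by
  have hg0 : aevalAeval (yFun F) (xFun F) g ≠ 0 := by
    rw [aevalAeval_yFun_xFun]
    intro h
    rw [FaithfulSMul.algebraMap_eq_zero_iff] at h
    exact hg (AdjoinRoot.mk_eq_zero.1 h)
  rcases hπ with ⟨h, rfl⟩ | ⟨h, rfl⟩
  · exact exists_mul_eq_mul_pow (v := q.val) q.val_const hx hy aevalAeval_yFun_xFun_self h g hg0
  · obtain ⟨n, s, u, hs, hu, hsu⟩ := exists_mul_eq_mul_pow (v := q.val) q.val_const hy hx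
      (F := Bivariate.swap F)
      (by rw [Bivariate.aevalAeval_swap]; exact aevalAeval_yFun_xFun_self)
      (by rw [swap_map_evalRingHom]; exact h)
      (Bivariate.swap g) (by rw [Bivariate.aevalAeval_swap]; exact hg0)
    refine ⟨n, Bivariate.swap s, Bivariate.swap u, ?_, ?_, ?_⟩
    · rwa [evalEval_swap]
    · rwa [evalEval_swap]
    · rw [Bivariate.aevalAeval_swap, Bivariate.aevalAeval_swap, ← hsu, Bivariate.aevalAeval_swap]

theorem CurvePoint.val_eq_val_pow {a b : ℂ} [IsDomain (AdjoinRoot F)] {π : RatFun F}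
    (q : CurvePoint F) (hx : q.HasValue (xFun F) a) (hy : q.HasValue (yFun F) b)
    {g s u : ℂ[X][X]} {n : ℕ} (hs : s.evalEval b a ≠ 0) (hu : u.evalEval b a ≠ 0)
    (h : aevalAeval (yFun F) (xFun F) s * aevalAeval (yFun F) (xFun F) g =
        aevalAeval (yFun F) (xFun F) u * π ^ n) :
    q.val (aevalAeval (yFun F) (xFun F) g) = q.val π ^ n := by
  have := congrArg q.val h
  rwa [map_mul, map_mul, map_pow, val_aevalAeval_eq_one (v := q.val) q.val_const hx hy hs,
    val_aevalAeval_eq_one (v := q.val) q.val_const hx hy hu, one_mul, one_mul] at this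

theorem CurvePoint.val_local_parameter [IsDomain (AdjoinRoot F)] {a b : ℂ} {π : RatFun F}
    (hπ : ((derivative (F.map (evalRingHom b))).eval a ≠ 0 ∧ π = yFun F - algebraMap ℂ _ b) ∨
      ((derivative (F.eval (C a))).eval b ≠ 0 ∧ π = xFun F - algebraMap ℂ _ a))
    (q : CurvePoint F) (hx : q.HasValue (xFun F) a) (hy : q.HasValue (yFun F) b) :
    q.val π = WithZero.exp (-1 : ℤ) := by
  have hπ1 : q.val π < 1 := by
    rcases hπ with ⟨-, rfl⟩ | ⟨-, rfl⟩
    exacts [hy, hx]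
  have hu := q.isUnit_of_val_mk (WithZero.log (q.val π)) fun p hp => by
    obtain ⟨n, s, u, hs, hu, h⟩ := exists_local_factorisation hπ q hx hy p hp
    have hval := q.val_eq_val_pow hx hy hs hu h
    refine ⟨n, ?_⟩
    rw [hval]
    rcases eq_or_ne (q.val π) 0 with h0 | h0
    · rcases n.eq_zero_or_pos with rfl | hn
      · simp
      · exfalso
        rw [h0, zero_pow hn.ne', Valuation.zero_iff, aevalAeval_yFun_xFun,
          FaithfulSMul.algebraMap_eq_zero_iff] at hval
        exact hp (AdjoinRoot.mk_eq_zero.1 hval)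
    · rw [← nsmul_eq_mul, WithZero.exp_nsmul, WithZero.exp_log h0]
  -- The logarithm of `0` is `0` by convention, which is not a unit.
  rcases eq_or_ne (q.val π) 0 with h0 | h0
  · rw [h0, WithZero.log_zero] at hu
    exact absurd hu not_isUnit_zero
  · rw [← WithZero.exp_log h0, ← WithZero.exp_zero, WithZero.exp_lt_exp] at hπ1
    rw [← WithZero.exp_log h0]
    congr 1
    rcases Int.isUnit_iff.1 hu with h | h <;> omega

/-- The local factorisation is an identity of functions, so it applies to both valuations and gives
the same exponent. -/
theorem CurvePoint.eq_of_hasValue [IsDomain (AdjoinRoot F)] (hsm : IsSmoothAffine F) {a b : ℂ}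
    {q r : CurvePoint F} (hqx : q.HasValue (xFun F) a) (hqy : q.HasValue (yFun F) b)
    (hrx : r.HasValue (xFun F) a) (hry : r.HasValue (yFun F) b) : q = r := by
  have h0 := evalEval_eq_zero_of_aevalAeval (v := q.val) q.val_const hqx hqy
    (aevalAeval_yFun_xFun_self (F := F))
  obtain ⟨π, hπ⟩ : ∃ π : RatFun F, ((derivative (F.map (evalRingHom b))).eval a ≠ 0 ∧
      π = yFun F - algebraMap ℂ _ b) ∨
      ((derivative (F.eval (C a))).eval b ≠ 0 ∧ π = xFun F - algebraMap ℂ _ a) := by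
    rcases hsm a b h0 with h | h
    exacts [⟨_, Or.inl ⟨h, rfl⟩⟩, ⟨_, Or.inr ⟨h, rfl⟩⟩]
  refine CurvePoint.ext_of_mk fun p => ?_
  by_cases hp : F ∣ p
  · rw [aevalAeval_yFun_xFun, AdjoinRoot.mk_eq_zero.2 hp]
    simp
  · obtain ⟨n, s, u, hs, hu, h⟩ := exists_local_factorisation hπ q hqx hqy p hp
    rw [q.val_eq_val_pow hqx hqy hs hu h, r.val_eq_val_pow hrx hry hs hu h,
      q.val_local_parameter hπ hqx hqy, r.val_local_parameter hπ hrx hry]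

theorem CurvePoint.hasOrder_xFun_sub [IsDomain (AdjoinRoot F)] (hsm : IsSmoothAffine F) {a b : ℂ}
    (q : CurvePoint F) (hx : q.HasValue (xFun F) a) (hy : q.HasValue (yFun F) b)
    (hF0 : F.eval (C a) ≠ 0) :
    q.HasOrder (xFun F - algebraMap ℂ _ a) ((F.eval (C a)).rootMultiplicity b) :=
  val_sub_eq_exp_rootMultiplicity (v := q.val) q.val_const hx hy aevalAeval_yFun_xFun_self hsm hF0
    (fun h => q.val_local_parameter (Or.inl ⟨h, rfl⟩) hx hy)
    (fun h => q.val_local_parameter (Or.inr ⟨h, rfl⟩) hx hy)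

theorem CurvePoint.hasOrder_yFun_sub [IsDomain (AdjoinRoot F)] (hsm : IsSmoothAffine F) {a b : ℂ}
    (q : CurvePoint F) (hx : q.HasValue (xFun F) a) (hy : q.HasValue (yFun F) b)
    (hF0 : F.map (evalRingHom b) ≠ 0) :
    q.HasOrder (yFun F - algebraMap ℂ _ b) ((F.map (evalRingHom b)).rootMultiplicity a) := by
  have e1 : (-Bivariate.swap F).eval (C b) = -F.map (evalRingHom b) := by
    rw [eval_neg, swap_eval_C]
  have e2 : (-Bivariate.swap F).map (evalRingHom a) = -F.eval (C a) := by
    rw [Polynomial.map_neg, swap_map_evalRingHom]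
  have := val_sub_eq_exp_rootMultiplicity (v := q.val) q.val_const hy hx
    (F := -Bivariate.swap F)
    (by rw [map_neg, Bivariate.aevalAeval_swap, aevalAeval_yFun_xFun_self, neg_zero]) hsm.neg_swap
    (by rw [e1]; exact neg_ne_zero.2 hF0)
    (fun h => q.val_local_parameter (Or.inr ⟨by
      rw [e2, derivative_neg, eval_neg] at h
      exact neg_ne_zero.1 h, rfl⟩) hx hy)
    (fun h => q.val_local_parameter (Or.inl ⟨by
      rw [e1, derivative_neg, eval_neg] at h
      exact neg_ne_zero.1 h, rfl⟩) hx hy)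
  rw [e1] at this
  rw [CurvePoint.HasOrder, this]
  congr 3
  rw [← count_roots, ← count_roots, roots_neg]

end AffinePoints

/-! ### Restriction of the curve to the coordinate axes. -/

section CyclicCurve

variable {N : ℕ}

theorem neg_swap_cyclicCurve_monic (hN : 0 < N) (ds : List (Fin N → ℂ)) (hm0 : 0 < ds.length)
    (hm : Nat.Coprime ds.length N) : (-Bivariate.swap (cyclicCurve ds)).Monic := by
  have hzero : ∀ a, N < a → (cyclicCurve ds).coeff a = 0 := fun a ha =>
    coeff_eq_zero_of_natDegree_lt (by rwa [cyclicCurve_natDegree])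
  refine monic_of_natDegree_le_of_coeff_eq_one ds.length ?_ ?_
  · rw [natDegree_le_iff_coeff_eq_zero]
    intro b hb
    ext a
    rw [coeff_neg, coeff_neg, coeff_coeff_swap]
    rcases lt_or_ge N a with ha | ha
    · simp [hzero a ha]
    · rw [cyclicCurve_coeff_coeff_of_lt hN ds a b ha, neg_zero, coeff_zero]
      calc ds.length * (N - a) ≤ ds.length * N := Nat.mul_le_mul_left _ (Nat.sub_le _ _)
        _ < b * N := Nat.mul_lt_mul_of_pos_right hb hN
        _ = N * b := mul_comm _ _
  · ext a
    rw [coeff_neg, coeff_neg, coeff_coeff_swap]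
    rcases a.eq_zero_or_pos with rfl | ha0
    · rw [cyclicCurve_coeff_coeff_of_eq hN ds hm 0 ds.length (Nat.zero_le _)
        (by rw [Nat.sub_zero, mul_comm])]
      simp [hN.ne]
    rcases lt_or_ge N a with ha | ha
    · simp [hzero a ha, coeff_one, ha0.ne']
    · rw [cyclicCurve_coeff_coeff_of_lt hN ds a ds.length ha, neg_zero, coeff_one, if_neg ha0.ne']
      rw [mul_comm N]
      exact Nat.mul_lt_mul_of_pos_left (by omega) hm0

theorem cyclicCurve_eval_zero (hN : 0 < N) (ds : List (Fin N → ℂ)) :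
    ∃ c : ℂ, c ≠ 0 ∧ (cyclicCurve ds).eval (C 0) =
      C c * (ds.map fun d => X - C ((-1) ^ N * ∏ i, d i)).prod := by
  refine ⟨(-1) ^ N * (-(-1) ^ N) ^ ds.length, by simp, ?_⟩
  rw [cyclicCurve, Matrix.eval_charpoly, C_0, map_zero, zero_sub, Matrix.det_neg,
    Fintype.card_fin, det_cyclicProd _ _ hN, List.map_map]
  have h1 : ∀ d : Fin N → ℂ, ((fun d : Fin N → ℂ[X] => ∏ i, d i - (-1) ^ N * X) ∘
      fun (d : Fin N → ℂ) i => C (d i)) d =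
      C (-(-1) ^ N) * (X - C ((-1) ^ N * ∏ i, d i)) := by
    intro d
    have h2 : ((-1 : ℂ[X]) ^ N) * (-1) ^ N = 1 := by rw [← mul_pow]; simp
    simp only [Function.comp, map_neg, map_mul, map_pow, map_one, map_prod]
    linear_combination (-∏ i, C (d i)) * h2
  rw [List.map_congr_left (fun d _ => h1 d), List.prod_map_mul, map_mul, map_pow C (-(-1) ^ N)]
  simp [mul_assoc]

theorem cyclicCurve_map_eval_zero (ds : List (Fin N → ℂ)) :
    (cyclicCurve ds).map (evalRingHom 0) = ∏ i, (X - C ((ds.map fun d => d i).prod)) := by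
  rw [cyclicCurve, ← Matrix.charpoly_map, cyclicProd_map, List.map_map]
  have h : (ds.map ((fun (d : Fin N → ℂ[X]) i => evalRingHom 0 (d i)) ∘
      fun (d : Fin N → ℂ) i => C (d i))) = ds := by
    conv_rhs => rw [← List.map_id ds]
    refine List.map_congr_left fun d _ => funext fun i => ?_
    simp
  rw [h]
  simp only [coe_evalRingHom, eval_X]
  exact charpoly_cyclicProd_zero_right ds

/-- The function `x` is integral over `ℂ[y]`, so every pole of `x` is a pole of `y`. -/
theorem CurvePoint.val_xFun_le_one {F : ℂ[X][X]} [IsDomain (AdjoinRoot F)] (hmon : F.Monic)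
    (q : CurvePoint F) (hy : q.val (yFun F) ≤ 1) : q.val (xFun F) ≤ 1 := by
  by_contra! hx
  have h0 := aevalAeval_yFun_xFun_self (F := F)
  rw [aevalAeval_eq_sum _ _ F (Nat.lt_succ_self _), Finset.sum_range_succ, hmon.coeff_natDegree,
    map_one, one_mul] at h0
  have h1 : q.val (∑ a ∈ Finset.range F.natDegree, aeval (yFun F) (F.coeff a) * xFun F ^ a) <
      q.val (xFun F ^ F.natDegree) := by
    have hpos : 0 < q.val (xFun F) := zero_lt_one.trans hx
    rw [map_pow]
    refine Valuation.map_sum_lt _ (pow_pos hpos _).ne' fun a ha => ?_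
    rw [map_mul, map_pow]
    calc _ ≤ 1 * q.val (xFun F) ^ a :=
          mul_le_mul_left (val_aeval_le_one (v := q.val) q.val_const hy _) _
      _ = q.val (xFun F) ^ a := one_mul _
      _ < _ := pow_lt_pow_right₀ hx (Finset.mem_range.1 ha)
  rw [eq_neg_of_add_eq_zero_left h0, Valuation.map_neg] at h1
  exact h1.false

theorem CurvePoint.exists_isPointAt (hN : 0 < N) (ds : List (Fin N → ℂ)) (hm0 : 0 < ds.length)
    (hm : Nat.Coprime ds.length N) (hsm : IsSmoothAffine (cyclicCurve ds)) {a b : ℂ}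
    (h0 : (cyclicCurve ds).evalEval b a = 0) :
    ∃ P : CurvePoint (cyclicCurve ds), P.IsPointAt a b := by
  have := isDomain_adjoinRoot_cyclicCurve hN ds hm
  obtain ⟨P, hx, hy⟩ := exists_curvePoint_hasValue (cyclicCurve_monic ds)
    (neg_swap_cyclicCurve_monic hN ds hm0 hm) hsm h0
  exact ⟨P, ⟨hx, hy⟩, fun q hqx hqy => CurvePoint.eq_of_hasValue hsm hqx hqy hx hy⟩

theorem rootMultiplicity_prod_X_sub_C {n : ℕ} (r : Fin n → ℂ) (c : ℂ) :
    (∏ j, (X - C (r j))).rootMultiplicity c = {j | r j = c}.ncard := by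
  have h : ∏ j, (X - C (r j)) = ((Finset.univ.val.map r).map fun a => X - C a).prod := by
    rw [Multiset.map_map]; rfl
  rw [← count_roots, h, roots_multiset_prod_X_sub_C, Multiset.count_map, Set.ncard_eq_toFinset_card']
  rw [Finset.card_def]
  congr 1
  simp only [Set.toFinset_ofPred, Finset.filter_val]
  refine Multiset.filter_congr fun j _ => eq_comm

end CyclicCurve

/-! ### The zeros of `x` and `y` and the expansions at infinity. -/

section Divisors

variable {M K N : ℕ} {I V : ℤ → ℤ → ℂ}

/-- The value of `y` at the point `A_j`. -/
def yCoordA (K N : ℕ) (I : ℤ → ℤ → ℂ) (j : ℕ) : ℂ :=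
  (-1) ^ N * ∏ i : Fin N, I ((i : ℤ) + 1) (-((j : ℤ) * K))

/-- The value of `y` at the point `B_j`. -/
def yCoordB (M N : ℕ) (V : ℤ → ℤ → ℂ) (j : ℕ) : ℂ :=
  (-1) ^ N * ∏ i : Fin N, V ((i : ℤ) + 1) (-((j : ℤ) * M))

theorem cyclicCurve_laxDiagonals_eval_zero (hN : 0 < N) :
    ∃ c : ℂ, c ≠ 0 ∧ (cyclicCurve (laxDiagonals M K N I V 0)).eval (C 0) =
      C c * ((∏ j : Fin M, (X - C (yCoordA K N I j))) * ∏ j : Fin K, (X - C (yCoordB M N V j))) := by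
  obtain ⟨c, hc, h⟩ := cyclicCurve_eval_zero hN (laxDiagonals M K N I V 0)
  refine ⟨c, hc, ?_⟩
  rw [h, laxDiagonals, List.map_append, List.prod_append, List.map_reverse, List.map_reverse,
    List.prod_reverse, List.map_map, List.map_map, mul_comm (List.prod _)]
  rw [Fin.prod_univ_eq_prod_range (fun j => X - C (yCoordA K N I j)),
    Fin.prod_univ_eq_prod_range (fun j => X - C (yCoordB M N V j))]
  simp only [Function.comp_def, zero_sub]
  rfl

theorem exists_zeros_x (hM : 0 < M) (hN : 0 < N) (hm : Nat.Coprime (M + K) N) {F : ℂ[X][X]}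
    (hF : F = cyclicCurve (laxDiagonals M K N I V 0)) (hsm : IsSmoothAffine F) :
    ∃ (A : Fin M → CurvePoint F) (B : Fin K → CurvePoint F),
      (∀ j, (A j).IsPointAt 0 (yCoordA K N I j)) ∧ (∀ j, (B j).IsPointAt 0 (yCoordB M N V j)) ∧
      ∀ p : CurvePoint F, p.HasValue (xFun F) 0 →
        p.HasOrder (xFun F) (({j | A j = p}.ncard : ℤ) + ({j | B j = p}.ncard : ℤ)) := by
  subst hF
  set ds := laxDiagonals M K N I V 0 with hds
  have hlen : ds.length = M + K := length_laxDiagonals 0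
  have hm0 : 0 < ds.length := by omega
  rw [← hlen] at hm
  have := isDomain_adjoinRoot_cyclicCurve hN ds hm
  obtain ⟨c, hc, hf⟩ := cyclicCurve_laxDiagonals_eval_zero (M := M) (K := K) (I := I) (V := V) hN
  rw [← hds] at hf
  set f := (cyclicCurve ds).eval (C 0) with hfdef
  have hPA : (∏ j : Fin M, (X - C (yCoordA K N I j))) ≠ 0 :=
    Finset.prod_ne_zero_iff.2 fun j _ => X_sub_C_ne_zero _
  have hPB : (∏ j : Fin K, (X - C (yCoordB M N V j))) ≠ 0 :=
    Finset.prod_ne_zero_iff.2 fun j _ => X_sub_C_ne_zero _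
  have hCc : C c ≠ 0 := C_ne_zero.2 hc
  have hf0 : f ≠ 0 := by
    rw [hf]
    exact mul_ne_zero hCc (mul_ne_zero hPA hPB)
  have hA : ∀ j : Fin M, (cyclicCurve ds).evalEval (yCoordA K N I j) 0 = 0 := by
    intro j
    change f.eval _ = 0
    rw [hf, eval_mul, eval_mul, eval_prod, Finset.prod_eq_zero (Finset.mem_univ j) (by simp)]
    simp
  have hB : ∀ j : Fin K, (cyclicCurve ds).evalEval (yCoordB M N V j) 0 = 0 := by
    intro j
    change f.eval _ = 0
    rw [hf, eval_mul, eval_mul, eval_prod, eval_prod,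
      Finset.prod_eq_zero (i := j) (f := fun j : Fin K => eval _ (X - C (yCoordB M N V j)))
        (Finset.mem_univ j) (by simp)]
    simp
  choose A hA' using fun j => CurvePoint.exists_isPointAt hN ds hm0 hm hsm (hA j)
  choose B hB' using fun j => CurvePoint.exists_isPointAt hN ds hm0 hm hsm (hB j)
  refine ⟨A, B, hA', hB', fun p hp => ?_⟩
  have hx1 : p.val (xFun _) < 1 := by
    have := hp
    rwa [CurvePoint.HasValue, map_zero, sub_zero] at this
  have hy1 : p.val (yFun (cyclicCurve ds)) ≤ 1 := by
    by_contra! hpole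
    have := (p.val_of_pole hN ds hm0 hm hpole).1
    rw [this, ← WithZero.exp_zero, WithZero.exp_lt_exp] at hx1
    omega
  -- On the curve `F(0, y)` is a multiple of `x`. As it vanishes at `p`, so does one of its linear
  -- factors, which yields the value of `y`.
  have hfy : p.val (aeval (yFun _) f) < 1 := by
    obtain ⟨G₁, -, -, hFt, -⟩ := exists_taylor (cyclicCurve ds) 0 0
    have h0 := aevalAeval_yFun_xFun_self (F := cyclicCurve ds)
    have h1 : aevalAeval (yFun (cyclicCurve ds)) (xFun _) (cyclicCurve ds) =
        aeval (yFun _) f + xFun _ * aevalAeval (yFun _) (xFun _) G₁ := by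
      have h2 := congrArg (aevalAeval (yFun (cyclicCurve ds)) (xFun _)) hFt
      rw [map_add, map_mul, aevalAeval_C, ← hfdef] at h2
      rw [h2]
      simp
    rw [h0] at h1
    rw [eq_neg_of_add_eq_zero_left h1.symm, Valuation.map_neg, map_mul]
    exact mul_lt_one_of_lt_of_le hx1 (val_aevalAeval_le_one (v := p.val) p.val_const hx1.le hy1 _)
  obtain ⟨b, hb⟩ : ∃ b, p.HasValue (yFun _) b := by
    rw [hf, map_mul, aeval_C, map_mul, p.val_const c hc, one_mul, map_mul, map_prod, map_prod,
      map_mul] at hfy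
    simp only [map_sub, aeval_X, aeval_C] at hfy
    by_contra! hcon
    have h1 : ∀ {n : ℕ} (r : Fin n → ℂ),
        1 ≤ p.val (∏ j, (yFun (cyclicCurve ds) - algebraMap ℂ _ (r j))) := by
      intro n r
      rw [map_prod]
      exact Finset.one_le_prod' fun j _ => not_lt.1 (hcon (r j))
    exact absurd (one_le_mul (h1 _) (h1 _)) (not_le.2 hfy)
  have hord := p.hasOrder_xFun_sub hsm hp hb hf0
  rw [map_zero, sub_zero] at hord
  -- Points on `x = 0` are determined by their `y`-coordinate, so counting equal roots is counting
  -- equal points.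
  have hmult : f.rootMultiplicity b = {j | A j = p}.ncard + {j | B j = p}.ncard := by
    rw [hf, ← count_roots, roots_C_mul _ hc, roots_mul (mul_ne_zero hPA hPB), Multiset.count_add,
      count_roots, count_roots, rootMultiplicity_prod_X_sub_C, rootMultiplicity_prod_X_sub_C]
    have huniq : ∀ (q : CurvePoint (cyclicCurve ds)) (b' : ℂ), q.IsPointAt 0 b' →
        (b' = b ↔ q = p) := by
      intro q b' hq
      constructor
      · rintro rfl
        exact (hq.2 p hp hb).symm
      · rintro rfl
        by_contra hne
        have h1 := q.val.map_sub_lt hb hq.1.2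
        rw [sub_sub_sub_cancel_left, ← map_sub, q.val_const _ (sub_ne_zero.2 hne)] at h1
        exact h1.false
    congr 2
    · ext j; exact huniq _ _ (hA' j)
    · ext j; exact huniq _ _ (hB' j)
  rw [← hfdef, hmult] at hord
  exact_mod_cast hord

theorem exists_zeros_y (hM : 0 < M) (hN : 0 < N) (hm : Nat.Coprime (M + K) N) {F : ℂ[X][X]}
    (hF : F = cyclicCurve (laxDiagonals M K N I V 0)) (hsm : IsSmoothAffine F) :
    ∃ Q : Fin N → CurvePoint F,
      (∀ j, (Q j).IsPointAt ((laxDiagonals M K N I V 0).map fun d => d j).prod 0) ∧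
      ∀ p : CurvePoint F, p.HasValue (yFun F) 0 →
        p.HasOrder (yFun F) ({j | Q j = p}.ncard : ℤ) := by
  subst hF
  set ds := laxDiagonals M K N I V 0 with hds
  have hlen : ds.length = M + K := length_laxDiagonals 0
  have hm0 : 0 < ds.length := by omega
  rw [← hlen] at hm
  have := isDomain_adjoinRoot_cyclicCurve hN ds hm
  have hf := cyclicCurve_map_eval_zero ds
  set f := (cyclicCurve ds).map (evalRingHom 0) with hfdef
  have hf0 : f ≠ 0 := ((cyclicCurve_monic ds).map _).ne_zero
  have hQ : ∀ j : Fin N, (cyclicCurve ds).evalEval 0 ((ds.map fun d => d j).prod) = 0 := by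
    intro j
    rw [← map_evalRingHom_eval, ← hfdef, hf, eval_prod,
      Finset.prod_eq_zero (Finset.mem_univ j) (by simp)]
  choose Q hQ' using fun j => CurvePoint.exists_isPointAt hN ds hm0 hm hsm (hQ j)
  refine ⟨Q, hQ', fun p hp => ?_⟩
  have hy1 : p.val (yFun _) < 1 := by
    have := hp
    rwa [CurvePoint.HasValue, map_zero, sub_zero] at this
  have hx1 : p.val (xFun (cyclicCurve ds)) ≤ 1 := p.val_xFun_le_one (cyclicCurve_monic ds) hy1.le
  have hfx : p.val (aeval (xFun _) f) < 1 := by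
    obtain ⟨G₁, -, -, hFt, -⟩ := exists_taylor (Bivariate.swap (cyclicCurve ds)) 0 0
    rw [swap_eval_C, ← hfdef] at hFt
    have h0 := aevalAeval_yFun_xFun_self (F := cyclicCurve ds)
    rw [← Bivariate.aevalAeval_swap] at h0
    have h1 : aevalAeval (xFun (cyclicCurve ds)) (yFun _) (Bivariate.swap (cyclicCurve ds)) =
        aeval (xFun _) f + yFun _ * aevalAeval (xFun _) (yFun _) G₁ := by
      conv_lhs => rw [hFt]
      simp
    rw [h0] at h1
    rw [eq_neg_of_add_eq_zero_left h1.symm, Valuation.map_neg, map_mul]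
    exact mul_lt_one_of_lt_of_le hy1 (val_aevalAeval_le_one (v := p.val) p.val_const hy1.le hx1 _)
  obtain ⟨a, ha⟩ : ∃ a, p.HasValue (xFun _) a := by
    rw [hf, map_prod] at hfx
    simp only [map_sub, aeval_X, aeval_C] at hfx
    by_contra! hcon
    rw [map_prod] at hfx
    exact absurd (Finset.one_le_prod' fun j _ => not_lt.1 (hcon _)) (not_le.2 hfx)
  have hord := p.hasOrder_yFun_sub hsm ha hp hf0
  rw [map_zero, sub_zero, ← hfdef, hf, rootMultiplicity_prod_X_sub_C] at hord
  have hset : {j | (ds.map fun d => d j).prod = a} = {j | Q j = p} := by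
    ext j
    simp only [Set.mem_ofPred_eq]
    constructor
    · intro h
      exact ((hQ' j).2 p (by rwa [h]) hp).symm
    · intro h
      by_contra hne
      have h2 := (hQ' j).1.1
      rw [h] at h2
      have h1 := p.val.map_sub_lt ha h2
      rw [sub_sub_sub_cancel_left, ← map_sub, p.val_const _ (sub_ne_zero.2 hne)] at h1
      exact h1.false
  rwa [hset] at hord

theorem exists_point_at_infinity (hM : 0 < M) (hN : 0 < N) (hm : Nat.Coprime (M + K) N)
    {F : ℂ[X][X]} (hF : ∀ s, F = spectralPoly M K N I V s) :
    ∃ P : CurvePoint F,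
      (P.HasPole (xFun F) ∧ P.HasPole (yFun F)) ∧
      (∀ p : CurvePoint F, p.HasPole (xFun F) ∨ p.HasPole (yFun F) → p = P) ∧
      ∃ k : (RatFun F)ˣ,
        P.HasOrder (k : RatFun F) 1 ∧
        P.LeadingTerm (xFun F) ((k ^ (-((M : ℤ) + K)) : (RatFun F)ˣ) : RatFun F) ∧
        P.LeadingTerm (yFun F) ((k ^ (-(N : ℤ)) : (RatFun F)ˣ) : RatFun F) ∧
        ∀ s : ℤ,
          (∃ w : Fin N → RatFun F, IsEigenvector F (laxMatrix M K N I V s) w) ∧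
          ∀ w : Fin N → RatFun F, IsEigenvector F (laxMatrix M K N I V s) w →
            ∃ c : (RatFun F)ˣ, ∀ i : Fin N,
              P.LeadingTerm ((c : RatFun F) * w i) ((k : RatFun F) ^ (N - 1 - (i : ℕ))) := by
  set ds := laxDiagonals M K N I V 0 with hds
  have hFds : F = cyclicCurve ds := by rw [hF 0, spectralPoly_eq_cyclicCurve]
  have hlen : ds.length = M + K := length_laxDiagonals 0
  have hm0 : 0 < ds.length := by omega
  have hm' : Nat.Coprime ds.length N := by rwa [hlen]
  have hdom : IsDomain (AdjoinRoot F) := by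
    rw [hFds]; exact isDomain_adjoinRoot_cyclicCurve hN ds hm'
  obtain ⟨P, hPy⟩ : ∃ P : CurvePoint F, P.HasPole (yFun _) := by
    rw [hFds]; exact exists_curvePoint_pole hN ds hm'
  have hval : P.val (xFun F) = WithZero.exp ((M + K : ℕ) : ℤ) ∧
      P.val (yFun F) = WithZero.exp (N : ℤ) := by
    subst hFds
    rw [← hlen]
    exact ⟨(P.val_of_pole hN ds hm0 hm' hPy).1, (P.val_of_pole hN ds hm0 hm' hPy).2.1⟩
  have hunique : ∀ p : CurvePoint F, p.HasPole (yFun F) → p = P := by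
    subst hFds
    exact fun p hp => p.eq_of_pole hN ds hm0 hm' P hp hPy
  have hmon : F.Monic := by rw [hFds]; exact cyclicCurve_monic ds
  have hlt : P.val (xFun F ^ N - yFun F ^ (M + K)) < P.val (yFun F ^ (M + K)) := by
    have h0 : aevalAeval (yFun F) (xFun F) (cyclicCurve ds) = 0 := by
      rw [← hFds]; exact aevalAeval_yFun_xFun_self
    have h1 := val_pow_sub_pow_lt (v := P.val) P.val_const hN ds hm0 hm' h0 hPy
    rw [val_pow_eq_val_pow (v := P.val) P.val_const hN ds hm0 hm' h0 hPy, max_self, hlen] at h1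
    rwa [map_pow]
  obtain ⟨hx, hy⟩ := hval
  obtain ⟨k, hk, hkx, hky⟩ := exists_local_parameter (v := P.val) hm hx hy hlt
  have hk0 : k ≠ 0 := by
    rintro rfl
    rw [map_zero] at hk
    exact WithZero.exp_ne_zero hk.symm
  have hk1 : P.val k < 1 := by
    rw [hk, ← WithZero.exp_zero, WithZero.exp_lt_exp]
    omega
  have hlead : ∀ (z : RatFun F) (n : ℕ), P.val (z * k ^ n - 1) < 1 →
      P.LeadingTerm z ((Units.mk0 k hk0 ^ (-(n : ℤ)) : (RatFun F)ˣ) : RatFun F) := by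
    intro z n hz
    rw [CurvePoint.LeadingTerm, Units.val_zpow_eq_zpow_val, Units.val_mk0, zpow_neg, zpow_natCast]
    have hkn : k ^ n ≠ 0 := pow_ne_zero _ hk0
    have e : z - (k ^ n)⁻¹ = (z * k ^ n - 1) * (k ^ n)⁻¹ := by
      field_simp
    rw [e, map_mul]
    have hpos : 0 < P.val (k ^ n)⁻¹ := (Valuation.pos_iff P.val).2 (inv_ne_zero hkn)
    simpa using mul_lt_mul_of_pos_right hz hpos
  refine ⟨P, ⟨?_, hPy⟩, ?_, Units.mk0 k hk0, hk, ?_, hlead _ N hky, fun s => ⟨?_, ?_⟩⟩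
  · rw [CurvePoint.HasPole, hx, ← WithZero.exp_zero, WithZero.exp_lt_exp]
    omega
  · intro p hp
    apply hunique
    by_contra hpy
    rcases hp with hp | hp
    · exact absurd (p.val_xFun_le_one hmon (not_lt.1 hpy)) (not_le.2 hp)
    · exact hpy hp
  · have := hlead _ _ hkx
    rwa [Nat.cast_add] at this
  · exact exists_isEigenvector s (hF s)
  · rintro w ⟨hw0, hw⟩
    rw [laxMatrix_map] at hw
    have hlen' : (laxDiagonals M K N I V s).length = M + K := length_laxDiagonals s
    obtain ⟨c, hc0, hc⟩ := exists_scaling_of_eigenvector (v := P.val) P.val_const hN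
      (laxDiagonals M K N I V s) (by rwa [hlen']) hk0 hk1 (by rwa [hlen']) hky hw0 hw
    exact ⟨Units.mk0 c hc0, hc⟩

end Divisors

end RndKP

end

open RndKP in
theorem proposition2p1 (M K N : ℕ) (hM : 0 < M) (hK : 0 < K) (hN : 0 < N)
    (hMK : Nat.Coprime M K) (hMKN : Nat.Coprime (M + K) N)
    (I V : ℤ → ℤ → ℂ) (hIV : IsSolution M K N I V) (t : ℤ) (F : ℂ[X][X])
    (hF : F = spectralPoly M K N I V t) (hsmooth : IsSmoothAffine F) :
    -- the points `A_j`, `B_j`; together they are the zeros of `x`, with multiplicity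
    (∃ (A : Fin M → CurvePoint F) (B : Fin K → CurvePoint F),
      (∀ j, (A j).IsPointAt 0 ((-1) ^ N * ∏ i : Fin N, I ((i : ℤ) + 1) (-((j : ℤ) * K)))) ∧
      (∀ j, (B j).IsPointAt 0 ((-1) ^ N * ∏ i : Fin N, V ((i : ℤ) + 1) (-((j : ℤ) * M)))) ∧
      ∀ p : CurvePoint F, p.HasValue (xFun F) 0 →
        p.HasOrder (xFun F) (({j | A j = p}.ncard : ℤ) + ({j | B j = p}.ncard : ℤ))) ∧
    -- the points `Q_j`, which are the zeros of `y`, with multiplicity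
    (∃ Q : Fin N → CurvePoint F,
      (∀ (j : Fin N) (s : ℤ), (Q j).IsPointAt
        ((∏ k ∈ Finset.Icc 1 K, V ((j : ℤ) + 1) (s - (k : ℕ))) *
          ∏ k ∈ Finset.Icc 1 M, I ((j : ℤ) + 1) (s - (k : ℕ))) 0) ∧
      ∀ p : CurvePoint F, p.HasValue (yFun F) 0 →
        p.HasOrder (yFun F) ({j | Q j = p}.ncard : ℤ)) ∧
    -- the point `P`, the only point at infinity, and the expansions there
    (∃ P : CurvePoint F,
      (P.HasPole (xFun F) ∧ P.HasPole (yFun F)) ∧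
      (∀ p : CurvePoint F, p.HasPole (xFun F) ∨ p.HasPole (yFun F) → p = P) ∧
      ∃ k : (RatFun F)ˣ,
        P.HasOrder (k : RatFun F) 1 ∧
        P.LeadingTerm (xFun F) ((k ^ (-((M : ℤ) + K)) : (RatFun F)ˣ) : RatFun F) ∧
        P.LeadingTerm (yFun F) ((k ^ (-(N : ℤ)) : (RatFun F)ˣ) : RatFun F) ∧
        ∀ s : ℤ,
          (∃ w : Fin N → RatFun F, IsEigenvector F (laxMatrix M K N I V s) w) ∧
          ∀ w : Fin N → RatFun F, IsEigenvector F (laxMatrix M K N I V s) w →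
            ∃ c : (RatFun F)ˣ, ∀ i : Fin N,
              P.LeadingTerm ((c : RatFun F) * w i) ((k : RatFun F) ^ (N - 1 - (i : ℕ)))) := by
  have hFs : ∀ s, F = spectralPoly M K N I V s := fun s => by
    rw [hF, hIV.spectralPoly_eq hM hK hMK t s]
  have hF0 : F = cyclicCurve (laxDiagonals M K N I V 0) := by
    rw [hFs 0, spectralPoly_eq_cyclicCurve]
  refine ⟨exists_zeros_x hM hN hMKN hF0 hsmooth, ?_, exists_point_at_infinity hM hN hMKN hFs⟩
  obtain ⟨Q, hQ, hQ'⟩ := exists_zeros_y hM hN hMKN hF0 hsmooth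
  refine ⟨Q, fun j s => ?_, hQ'⟩
  -- For every `s` the product is the same diagonal entry of `X_0(0)`, so one point serves all `s`.
  rw [← hIV.prod_laxDiagonals hK hMK 0 s j]
  exact hQ j
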